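/- Let $x$ be a formal positive infinitesimal variable, $\boldsymbol\ell_0=x$, $\boldsymbol\ell=\boldsymbol\ell_1=\frac{1}{-\log x}$, $\boldsymbol\ell_{i+1}=\boldsymbol\ell\circ\boldsymbol\ell_i$. For $j\ge 0$ let $\widehat{\mathcal L}_j^\infty$ be the set of all real transseries $$\sum_{i_0=0}^\infty\cdots\sum_{i_j=0}^\infty a_{i_0\ldots i_j}\,x^{\alpha_{i_0}}\boldsymbol\ell_1^{\alpha_{i_0i_1}}\cdots\boldsymbol\ell_j^{\alpha_{i_0\ldots i_j}},$$ where each sequence $(\alpha_{i_0\ldots i_k})_{i_k}$ of real numbers is strictly increasing to $+\infty$. Let $\widehat{\mathcal L}_j\subset\widehat{\mathcal L}_j^\infty$ be the subset where all exponents of $x$ are positive, let $\widehat{\mathcal L}\subset\widehat{\mathcal L}_1$ be the subset with only integer powers of $\boldsymbol\ell$, and let $\widehat{\mathfrak L}=\bigcup_j\widehat{\mathcal L}_j^\infty$. Theorem A. Let $\widehat f\in\widehat{\mathcal L}$ be parabolic, i.e. with leading term $x$, and suppose that $\widehat g=\mathrm{id}-\widehat f$ is nonzero with positive leading coefficient.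 Then: (1) $\widehat g$ has a unique formal compositional inverse $\widehat g^{-1}$ in $\widehat{\mathfrak L}$; (2) $\widehat f$ has a formal Fatou coordinate, i.e. there is $\widehat\Psi\in\widehat{\mathfrak L}$ with $\widehat\Psi\circ\widehat f-\widehat\Psi=1$, and it is unique up to an additive real constant; (3) the formal continuous time length of $\varepsilon$-neighborhoods of orbits $$\widehat A^c_{\widehat f}(\varepsilon)=\widehat g^{-1}(2\varepsilon)+2\varepsilon\,\widehat\Psi\big(\widehat g^{-1}(2\varepsilon)\big)$$ is well defined up to a term $K\varepsilon$, $K\in\mathbb R$, and (for every choice of $\widehat\Psi$) it belongs to $\widehat{\mathcal L}_2$. In particular it is a transseries with well-ordered support made of monomials $\varepsilon^{\alpha}\boldsymbol\ell(\varepsilon)^{\gamma_1}\boldsymbol\ell_2(\varepsilon)^{\gamma_2}$, $\alpha>0$, $\gamma_1,\gamma_2\in\mathbb R$. -/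

import Mathlib

/-!
# Power-iterated-logarithm transseries

Formal variable `x` (positive, tending to `0`), `ℓ₀ = x`, `ℓ₁ = ℓ = 1 / (-log x)`, and
`ℓ_{i+1} = ℓ(ℓ_i) = 1 / (-log ℓ_i)`.
-/

namespace Transseries

noncomputable section

/-- Exponents of monomials: `γ` stands for `x ^ γ₀ * ℓ₁ ^ γ₁ * ℓ₂ ^ γ₂ * ⋯` (finitely many nonzero
exponents), with the lexicographic order (the smaller exponent is the dominant monomial). -/
abbrev Expo : Type := Lex (ℕ →₀ ℝ)

/-- The `i`-th exponent of `γ`. -/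
def Expo.at (γ : Expo) (i : ℕ) : ℝ := ofLex γ i

/-- The exponent of the monomial `ℓ_i ^ a`. -/
def Expo.ell (i : ℕ) (a : ℝ) : Expo := toLex (Finsupp.single i a)

/-- Real transseries with well-ordered support in these monomials. They form a field. -/
abbrev Series : Type := HahnSeries Expo ℝ

/-- The monomial `c * ℓ_i ^ a`. -/
def ellPow (i : ℕ) (a c : ℝ) : Series := HahnSeries.single (Expo.ell i a) c

/-- The transseries `x`, which is also the identity for composition. -/
def X : Series := ellPow 0 1 1

/-! ### The classes of transseries -/

/-- A set of reals has finitely many elements below every bound; equivalently, it is contained in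
the range of a strictly increasing sequence of reals tending to `+∞`. -/
def LeftFinite (S : Set ℝ) : Prop := ∀ c : ℝ, (S ∩ Set.Iic c).Finite

/-- The class `L_j^∞` of the sums
`∑_{i₀} ⋯ ∑_{i_j} a_{i₀…i_j} x ^ α_{i₀} ℓ₁ ^ α_{i₀i₁} ⋯ ℓ_j ^ α_{i₀…i_j}`, where each sequence
`(α_{i₀…i_k})_{i_k}` (all indices but the last one fixed) strictly increases to `+∞`: only
`ℓ₀, …, ℓ_j` occur, and for every choice `β` of the first `k` exponents the `k`-th exponents that
occur together with it form a left-finite set. -/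
def LInf (j : ℕ) : Set Series :=
  {F | (∀ γ ∈ F.support, ∀ i, j < i → γ.at i = 0) ∧
    ∀ k ≤ j, ∀ β : Expo,
      LeftFinite {a | ∃ γ ∈ F.support, (∀ i < k, γ.at i = β.at i) ∧ γ.at k = a}}

/-- The infinitesimal class `L_j`: all exponents of `x` are positive. -/
def L (j : ℕ) : Set Series := {F | F ∈ LInf j ∧ ∀ γ ∈ F.support, 0 < γ.at 0}

/-- The class of the elements of `L_1` with only integer powers of `ℓ`. -/
def LHat : Set Series := {F | F ∈ L 1 ∧ ∀ γ ∈ F.support, ∃ m : ℤ, γ.at 1 = m}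

/-- Power-iterated-logarithm transseries of finite depth: the union of all `L_j^∞`. -/
def LFrak : Set Series := {F | ∃ j, F ∈ LInf j}

/-- Parabolic (tangent to the identity): the leading term is `x`. -/
def IsParabolic (f : Series) : Prop := f.order = Expo.ell 0 1 ∧ f.leadingCoeff = 1

/-! ### Powers, logarithms and composition -/

/-- The relative tail `T` in `φ = c * m * (1 + T)`, where `c * m` is the leading term of `φ`. -/
def tail (φ : Series) : Series := HahnSeries.single (-φ.order) (φ.leadingCoeff)⁻¹ * φ - 1

/-- The real power `φ ^ a = c ^ a * m ^ a * (1 + T) ^ a` of `φ = c * m * (1 + T)`, `c > 0`, where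
`(1 + T) ^ a = ∑ n, (a choose n) T ^ n`. -/
def rpow (φ : Series) (a : ℝ) : Series :=
  HahnSeries.single (toLex (a • ofLex φ.order)) (φ.leadingCoeff ^ a) *
    PowerSeries.heval (tail φ) (PowerSeries.binomialSeries ℝ a)

/-- The logarithm `log c + log m + log (1 + T)` of `φ = c * m * (1 + T)`, `c > 0`. Here
`log m = ∑ i, γ_i log ℓ_i = - ∑ i, γ_i ℓ_{i+1}⁻¹` for `m = ∏ i, ℓ_i ^ γ_i`, and
`log (1 + T) = T - T ^ 2 / 2 + ⋯`. -/
def log (φ : Series) : Series :=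
  HahnSeries.C (Real.log φ.leadingCoeff)
    + (ofLex φ.order).sum (fun i a => ellPow (i + 1) (-1) (-a))
    + PowerSeries.heval (tail φ) (PowerSeries.log ℝ)

/-- `ℓ_i ∘ φ`. -/
def ellComp (φ : Series) : ℕ → Series
  | 0 => φ
  | i + 1 => (-log (ellComp φ i))⁻¹

/-- `(∏ i, ℓ_i ^ β_i) ∘ φ = ∏ i, (ℓ_i ∘ φ) ^ β_i`. -/
def monoComp (φ : Series) (β : Expo) : Series :=
  (ofLex β).prod fun i b => rpow (ellComp φ i) b

/-- `χ` is the formal composition `ψ ∘ φ`: `φ` is positive (positive leading coefficient) and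
infinitesimal (positive leading exponent of `x`), the family of the `ψ_β * (m_β ∘ φ)`, over all
monomials `m_β`, is summable (well-ordered union of the supports, finitely many contributions to
each coefficient), and its sum is `χ`. -/
def IsComp (ψ φ χ : Series) : Prop :=
  0 < φ.leadingCoeff ∧ 0 < φ.order.at 0 ∧
    ∃ s : HahnSeries.SummableFamily Expo ℝ Expo,
      (∀ β, s β = ψ.coeff β • monoComp φ β) ∧ s.hsum = χ

/-! ### Formal inverse, formal Fatou coordinate, continuous time length -/

/-- `h` is a formal (two-sided compositional) inverse of `g`. -/
def IsFormalInverse (g h : Series) : Prop := h ∈ LFrak ∧ IsComp g h X ∧ IsComp h g X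

/-- `Ψ` is a formal Fatou coordinate of `f`: `Ψ ∘ f - Ψ = 1`. -/
def IsFormalFatou (f Ψ : Series) : Prop :=
  Ψ ∈ LFrak ∧ ∃ χ, IsComp Ψ f χ ∧ χ - Ψ = 1

/-- `A` is a formal continuous time length of `ε`-neighborhoods of orbits of `f`:
`A(ε) = h(2ε) + 2ε * Ψ(h(2ε))`, where `h` is the formal inverse of `id - f` and `Ψ` is a formal
Fatou coordinate of `f`. The formal variable `ε` is written `X`. -/
def IsFormalLength (f A : Series) : Prop :=
  ∃ h Ψ h₂ Φ : Series, IsFormalInverse (X - f) h ∧ IsFormalFatou f Ψ ∧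
    IsComp h ((2 : ℝ) • X) h₂ ∧ IsComp Ψ h₂ Φ ∧ A = h₂ + ((2 : ℝ) • X) * Φ

end

end Transseries

namespace Transseries

noncomputable section

open HahnSeries Pointwise Expo

/-! ### Exponents -/

namespace Expo

/-! Membership in `LInf J` depends on the support alone, through the condition `Tame J`. Tame sets
are well-ordered and stable under finite unions, sums, monoids generated by nonnegative exponents,
and the shears that substitutions induce on exponents (`Tame.isWF`, `Tame.add`, `Tame.closure`,
`Tame.image_shear`). Hence `LInf J` is a ring, closed under real powers of positive series, under
logarithms of those whose leading monomial stops before `ℓ_J`, and under composition with an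
`Admissible` series.

For fixed `φ`, the leading exponent `leadExpo φ β` of `m_β ∘ φ` is strictly increasing in `β`, and
the other exponents differ from it by elements of one well-ordered monoid. Composition is therefore
a strongly linear operator, determined by its values on monomials. This makes it a ring homomorphism
that commutes with powers and logarithms, and gives associativity (`Admissible.comp_comp`).

Both existence claims are triangular linear equations, solved coefficient by coefficient in
`exists_kernelMap_eq`. For the inverse the equation is `h ∘ g = x`; a left inverse of a left inverse
shows that `h` is two-sided, and `h` is unique because composition with `g` is injective.

For the Fatou coordinate write `f = x (1 + κ m_t + ⋯)`. If `ℓ_k ^ b` is the first factor of `m_β`,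
then `m_β ∘ f - m_β` starts with `b κ m_β m_t ℓ₁ ⋯ ℓ_k`, and this leading exponent is strictly
increasing in `β ≠ 0` (`shiftExpo_strictMonoOn`). So only constants are invariant under `f`. The
monomials in `x, ℓ₁` reach every leading monomial in `x, ℓ₁` except `m_t ℓ₁`; the monomial `ℓ₂⁻¹`
reaches that one, and its difference again involves only `x, ℓ₁`. Thus `Ψ` exists with depth 2
(`Parabolic.exists_fatou`).

If `α` is the leading exponent of `x` in `g`, it is `1 / α` in `g⁻¹`, while the exponents of `x` in
`Ψ` are at least `1 - α`. Hence those in `ε Ψ(g⁻¹(2ε))` are at least `1 + (1 - α) / α = 1 / α > 0`.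
-/

@[simp] lemma at_add (γ δ : Expo) (i : ℕ) : (γ + δ).at i = γ.at i + δ.at i := rfl
@[simp] lemma at_sub (γ δ : Expo) (i : ℕ) : (γ - δ).at i = γ.at i - δ.at i := rfl
@[simp] lemma at_neg (γ : Expo) (i : ℕ) : (-γ).at i = -γ.at i := rfl
@[simp] lemma at_zero (i : ℕ) : (0 : Expo).at i = 0 := rfl
@[simp] lemma at_smul (a : ℝ) (γ : Expo) (i : ℕ) : (a • γ).at i = a * γ.at i := rfl

protected lemma add_smul (a b : ℝ) (γ : Expo) : (a + b) • γ = a • γ + b • γ := by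
  refine Finsupp.ext fun i => add_mul a b _

lemma at_ell (i : ℕ) (a : ℝ) (k : ℕ) : (ell i a).at k = if i = k then a else 0 :=
  Finsupp.single_apply

@[simp] lemma at_ell_self (i : ℕ) (a : ℝ) : (ell i a).at i = a := by simp [at_ell]

@[ext] lemma ext' {γ δ : Expo} (h : ∀ i, γ.at i = δ.at i) : γ = δ :=
  Finsupp.ext h

lemma lt_iff {γ δ : Expo} : γ < δ ↔ ∃ k, (∀ i < k, γ.at i = δ.at i) ∧ γ.at k < δ.at k := Iff.rfl

lemma lt_of_at_lt {γ δ : Expo} {k : ℕ} (h : ∀ i < k, γ.at i = δ.at i) (hk : γ.at k < δ.at k) :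
    γ < δ := lt_iff.2 ⟨k, h, hk⟩

lemma at_le_of_le {γ δ : Expo} {k : ℕ} (h : ∀ i < k, γ.at i = δ.at i) (hle : γ ≤ δ) :
    γ.at k ≤ δ.at k := by
  by_contra! hk
  exact absurd (lt_of_at_lt (fun i hi => (h i hi).symm) hk) (not_lt.2 hle)

lemma at_zero_le {γ δ : Expo} (hle : γ ≤ δ) : γ.at 0 ≤ δ.at 0 :=
  at_le_of_le (fun _ hi => absurd hi (Nat.not_lt_zero _)) hle

lemma exists_at_ne_zero {γ : Expo} (h : γ ≠ 0) :
    ∃ k, γ.at k ≠ 0 ∧ ∀ i < k, γ.at i = 0 := by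
  classical
  have hex : ∃ k, γ.at k ≠ 0 := by
    by_contra! hc
    exact h (ext' hc)
  exact ⟨Nat.find hex, Nat.find_spec hex, fun i hi => by simpa using Nat.find_min hex hi⟩

/-- The exponents of the monomials in `ℓ₀, …, ℓ_J`. -/
def depth (J : ℕ) : Submodule ℝ Expo where
  carrier := {γ | ∀ i, J < i → γ.at i = 0}
  add_mem' ha hb i hi := by simp [ha i hi, hb i hi]
  zero_mem' _ _ := rfl
  smul_mem' c _ ha i hi := by simp [ha i hi]

lemma ell_mem_depth {J i : ℕ} (h : i ≤ J) (a : ℝ) : ell i a ∈ depth J := fun k hk => by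
  rw [at_ell, if_neg (by omega)]

lemma ell_add (i : ℕ) (a b : ℝ) : ell i (a + b) = ell i a + ell i b :=
  Finsupp.single_add ..

lemma smul_ell (i : ℕ) (a b : ℝ) : a • ell i b = ell i (a * b) := by
  ext k; simp [at_ell]

lemma neg_ell (i : ℕ) (b : ℝ) : -ell i b = ell i (-b) := by
  ext k; by_cases h : i = k <;> simp [at_ell, h]

lemma ell_pos (i : ℕ) {a : ℝ} (h : 0 < a) : 0 < ell i a :=
  lt_of_at_lt (k := i) (fun k hk => by simp [at_ell, hk.ne']) (by simpa using h)

end Expo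


/-! ### Left-finite sets of reals -/

namespace LeftFinite

lemma mono {S T : Set ℝ} (hT : LeftFinite T) (h : S ⊆ T) : LeftFinite S := fun c =>
  (hT c).subset (Set.inter_subset_inter_left _ h)

lemma of_finite {S : Set ℝ} (h : S.Finite) : LeftFinite S := fun _ => h.subset Set.inter_subset_left

lemma biUnion {ι : Type*} {I : Set ι} (hI : I.Finite) {S : ι → Set ℝ}
    (h : ∀ i ∈ I, LeftFinite (S i)) : LeftFinite (⋃ i ∈ I, S i) := fun c => by
  rw [Set.iUnion₂_inter]
  exact hI.biUnion fun i hi => h i hi c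

lemma union {S T : Set ℝ} (hS : LeftFinite S) (hT : LeftFinite T) : LeftFinite (S ∪ T) := fun c => by
  rw [Set.union_inter_distrib_right]
  exact (hS c).union (hT c)

lemma exists_isLeast {S : Set ℝ} (hS : LeftFinite S) (hne : S.Nonempty) : ∃ m, IsLeast S m := by
  obtain ⟨a, ha⟩ := hne
  obtain ⟨m, hm⟩ := (hS a).exists_minimal ⟨a, ha, le_refl a⟩
  refine ⟨m, hm.1.1, fun b hb => ?_⟩
  rcases le_total b a with h | h
  · rcases le_total m b with h' | h'
    · exact h'
    · exact hm.2 ⟨hb, h⟩ h'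
  · exact le_trans hm.1.2 h

lemma exists_lowerBound {S : Set ℝ} (hS : LeftFinite S) : ∃ m, ∀ a ∈ S, m ≤ a := by
  rcases S.eq_empty_or_nonempty with rfl | hne
  · exact ⟨0, by simp⟩
  · obtain ⟨m, hm⟩ := hS.exists_isLeast hne
    exact ⟨m, fun a ha => hm.2 ha⟩

/-- Both sets are bounded below, so a bound on the sum bounds each coordinate from above. -/
lemma finite_pairs_le {S T : Set ℝ} (hS : LeftFinite S) (hT : LeftFinite T) (c : ℝ) :
    {p : ℝ × ℝ | p.1 ∈ S ∧ p.2 ∈ T ∧ p.1 + p.2 ≤ c}.Finite := by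
  obtain ⟨m, hm⟩ := hS.exists_lowerBound
  obtain ⟨n, hn⟩ := hT.exists_lowerBound
  refine ((hS (c - n)).prod (hT (c - m))).subset ?_
  rintro ⟨a, b⟩ ⟨ha, hb, hab⟩
  have := hm a ha
  have := hn b hb
  simp only at hab
  exact ⟨⟨ha, by simp only [Set.mem_Iic]; linarith⟩, ⟨hb, by simp only [Set.mem_Iic]; linarith⟩⟩

lemma add {S T : Set ℝ} (hS : LeftFinite S) (hT : LeftFinite T) : LeftFinite (S + T) := fun c => by
  refine ((hS.finite_pairs_le hT c).image fun p => p.1 + p.2).subset ?_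
  rintro _ ⟨⟨a, ha, b, hb, rfl⟩, hc⟩
  exact ⟨(a, b), ⟨ha, hb, hc⟩, rfl⟩

end LeftFinite

/-! ### Tame sets of exponents -/

/-- The `k`-th exponents that occur in `S` together with the first `k` exponents of `β`. -/
def fiber (S : Set Expo) (k : ℕ) (β : Expo) : Set ℝ :=
  {a | ∃ γ ∈ S, (∀ i < k, γ.at i = β.at i) ∧ γ.at k = a}

/-- The condition on a set of exponents that defines the supports of the elements of `L_J^∞`. -/
def Tame (J : ℕ) (S : Set Expo) : Prop :=
  (∀ γ ∈ S, ∀ i, J < i → γ.at i = 0) ∧ ∀ k ≤ J, ∀ β, LeftFinite (fiber S k β)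

lemma fiber_mono {S T : Set Expo} (h : S ⊆ T) (k : ℕ) (β : Expo) : fiber S k β ⊆ fiber T k β := by
  rintro a ⟨γ, hγ, h'⟩
  exact ⟨γ, h hγ, h'⟩

namespace Tame

variable {J : ℕ} {S T : Set Expo}

lemma subset_depth (hS : Tame J S) : S ⊆ depth J := hS.1

lemma mono (hT : Tame J T) (h : S ⊆ T) : Tame J S :=
  ⟨fun γ hγ => hT.1 γ (h hγ), fun k hk β => (hT.2 k hk β).mono (fiber_mono h k β)⟩

lemma of_subset_singleton {γ : Expo} (hγ : γ ∈ depth J) (h : S ⊆ {γ}) : Tame J S := by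
  refine ⟨fun δ hδ => by rw [h hδ]; exact hγ, fun k _ β => ?_⟩
  refine LeftFinite.of_finite ((Set.finite_singleton (γ.at k)).subset ?_)
  rintro _ ⟨δ, hδ, -, rfl⟩
  rw [h hδ]; rfl

lemma singleton {γ : Expo} (hγ : γ ∈ depth J) : Tame J {γ} := of_subset_singleton hγ subset_rfl

lemma empty : Tame J ∅ := of_subset_singleton (zero_mem _) (Set.empty_subset _)

lemma union (hS : Tame J S) (hT : Tame J T) : Tame J (S ∪ T) := by
  refine ⟨fun γ hγ => hγ.elim (hS.1 γ) (hT.1 γ), fun k hk β => ?_⟩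
  refine ((hS.2 k hk β).union (hT.2 k hk β)).mono ?_
  rintro a ⟨γ, hγ | hγ, h⟩
  · exact Or.inl ⟨γ, hγ, h⟩
  · exact Or.inr ⟨γ, hγ, h⟩

lemma biUnion {ι : Type*} {I : Set ι} (hI : I.Finite) {S : ι → Set Expo}
    (h : ∀ i ∈ I, Tame J (S i)) : Tame J (⋃ i ∈ I, S i) := by
  refine ⟨fun γ hγ => ?_, fun k hk β => ?_⟩
  · obtain ⟨i, hi, hγ⟩ := Set.mem_iUnion₂.1 hγ
    exact (h i hi).1 γ hγ
  · refine (LeftFinite.biUnion hI fun i hi => (h i hi).2 k hk β).mono ?_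
    rintro a ⟨γ, hγ, h'⟩
    obtain ⟨i, hi, hγ⟩ := Set.mem_iUnion₂.1 hγ
    exact Set.mem_iUnion₂.2 ⟨i, hi, γ, hγ, h'⟩

lemma mono_depth {J' : ℕ} (h : J ≤ J') (hS : Tame J S) : Tame J' S := by
  refine ⟨fun γ hγ i hi => hS.1 γ hγ i (by omega), fun k hk β => ?_⟩
  by_cases hkJ : k ≤ J
  · exact hS.2 k hkJ β
  · refine LeftFinite.of_finite ((Set.finite_singleton 0).subset ?_)
    rintro _ ⟨γ, hγ, -, rfl⟩
    exact hS.1 γ hγ k (by omega)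

/-- The first `k` exponents, followed by zeros. -/
def _root_.Transseries.prefixFn (k : ℕ) (γ : Expo) : ℕ → ℝ := fun i => if i < k then γ.at i else 0

lemma _root_.Transseries.prefixFn_succ (k : ℕ) (γ : Expo) :
    prefixFn (k + 1) γ = Function.update (prefixFn k γ) k (γ.at k) := by
  ext i
  rcases lt_trichotomy i k with h | rfl | h
  · simp [prefixFn, h, h.ne, Nat.lt_succ_of_lt h]
  · simp [prefixFn]
  · rw [Function.update_of_ne h.ne']; simp [prefixFn, show ¬ i < k + 1 by omega, show ¬ i < k by omega]

lemma _root_.Transseries.at_eq_of_prefixFn_eq {k : ℕ} {γ δ : Expo} (h : prefixFn k γ = prefixFn k δ) :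
    ∀ i < k, γ.at i = δ.at i := fun i hi => by
  have := congrFun h i
  simpa [prefixFn, hi] using this

/-- Induction on `k`: over each of the finitely many pairs of prefixes already found, the next two
exponents lie in left-finite fibers and their sum is bounded, which leaves finitely many pairs. -/
lemma finite_prefixes (hS : Tame J S) (hT : Tame J T) (β : Expo) (k : ℕ) (hk : k ≤ J + 1) :
    {p : (ℕ → ℝ) × (ℕ → ℝ) | ∃ γ ∈ S, ∃ δ ∈ T, (∀ i < k, γ.at i + δ.at i = β.at i) ∧
      p = (prefixFn k γ, prefixFn k δ)}.Finite := by
  induction k with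
  | zero =>
    refine (Set.finite_singleton ((fun _ => 0 : ℕ → ℝ), (fun _ => 0 : ℕ → ℝ))).subset ?_
    rintro _ ⟨γ, -, δ, -, -, rfl⟩
    exact Prod.ext (funext fun i => by simp [prefixFn]) (funext fun i => by simp [prefixFn])
  | succ k ih =>
    specialize ih (by omega)
    refine (ih.biUnion (t := fun p => (fun q : ℝ × ℝ =>
      (Function.update p.1 k q.1, Function.update p.2 k q.2)) ''
        {q | q.1 ∈ {a | ∃ γ ∈ S, prefixFn k γ = p.1 ∧ γ.at k = a} ∧
          q.2 ∈ {a | ∃ δ ∈ T, prefixFn k δ = p.2 ∧ δ.at k = a} ∧ q.1 + q.2 ≤ β.at k})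
      fun p hp => ?_).subset ?_
    · obtain ⟨γ, hγ, δ, hδ, -, rfl⟩ := hp
      refine Set.Finite.image _ (LeftFinite.finite_pairs_le ?_ ?_ _)
      · refine (hS.2 k (by omega) γ).mono ?_
        rintro a ⟨γ', h1, h2, h3⟩
        exact ⟨γ', h1, at_eq_of_prefixFn_eq h2, h3⟩
      · refine (hT.2 k (by omega) δ).mono ?_
        rintro a ⟨γ', h1, h2, h3⟩
        exact ⟨γ', h1, at_eq_of_prefixFn_eq h2, h3⟩
    · rintro _ ⟨γ, hγ, δ, hδ, h, rfl⟩
      refine Set.mem_iUnion₂.2 ⟨(prefixFn k γ, prefixFn k δ),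
        ⟨γ, hγ, δ, hδ, fun i hi => h i (by omega), rfl⟩, (γ.at k, δ.at k), ?_, ?_⟩
      · exact ⟨⟨γ, hγ, rfl, rfl⟩, ⟨δ, hδ, rfl, rfl⟩, (h k (by omega)).le⟩
      · simp [prefixFn_succ]

/-- A fiber of `S + T` over a given prefix is covered by finitely many sums of a fiber of `S` and a
fiber of `T`, one for each splitting of the prefix. -/
lemma add (hS : Tame J S) (hT : Tame J T) : Tame J (S + T) := by
  refine ⟨?_, fun k hk β => ?_⟩
  · rintro _ ⟨γ, hγ, δ, hδ, rfl⟩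
    exact (depth J).add_mem (hS.1 γ hγ) (hT.1 δ hδ)
  · refine (LeftFinite.biUnion (finite_prefixes hS hT β k (by omega))
      (S := fun p => {a | ∃ γ ∈ S, prefixFn k γ = p.1 ∧ γ.at k = a} +
        {a | ∃ γ ∈ T, prefixFn k γ = p.2 ∧ γ.at k = a}) fun p hp => ?_).mono ?_
    · obtain ⟨γ, hγ, δ, hδ, -, rfl⟩ := hp
      refine LeftFinite.add ((hS.2 k hk γ).mono ?_) ((hT.2 k hk δ).mono ?_)
      all_goals
        rintro a ⟨γ', h1, h2, h3⟩
        exact ⟨γ', h1, at_eq_of_prefixFn_eq h2, h3⟩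
    · rintro _ ⟨_, ⟨γ, hγ, δ, hδ, rfl⟩, h, rfl⟩
      exact Set.mem_iUnion₂.2 ⟨_, ⟨γ, hγ, δ, hδ, h, rfl⟩, γ.at k, ⟨γ, hγ, rfl, rfl⟩,
        δ.at k, ⟨δ, hδ, rfl, rfl⟩, rfl⟩

/-! ### Generated monoids and well-ordering of tame sets -/

lemma nsmul (hS : Tame J S) (n : ℕ) : Tame J (n • S) := by
  induction n with
  | zero => rw [zero_nsmul]; exact singleton (zero_mem _)
  | succ n ih => rw [succ_nsmul]; exact ih.add hS

lemma _root_.Transseries.exists_mem_nsmul_of_mem_closure {γ : Expo} (h : γ ∈ AddSubmonoid.closure S) :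
    ∃ n : ℕ, γ ∈ n • S := by
  induction h using AddSubmonoid.closure_induction with
  | mem x hx => exact ⟨1, by rwa [one_nsmul]⟩
  | zero => exact ⟨0, by rw [zero_nsmul]; rfl⟩
  | add x y _ _ hx hy =>
    obtain ⟨n, hn⟩ := hx
    obtain ⟨m, hm⟩ := hy
    exact ⟨n + m, by rw [add_nsmul]; exact Set.add_mem_add hn hm⟩

/-- The `k`-th exponents on `S` form a left-finite set of positive numbers, so they have a lower
bound `d > 0`, and an `n`-fold sum has `k`-th exponent at least `n * d`. A bound on the `k`-th
exponent therefore bounds the number of summands. -/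
lemma closure_of_pos (hS : Tame J S) {k : ℕ} (h0 : ∀ γ ∈ S, ∀ i < k, γ.at i = 0)
    (hk : k ≤ J) (hpos : ∀ γ ∈ S, 0 < γ.at k) :
    Tame J (AddSubmonoid.closure S : Set Expo) := by
  obtain ⟨d, hd, hSd⟩ : ∃ d : ℝ, 0 < d ∧ ∀ γ ∈ S, d ≤ γ.at k := by
    rcases S.eq_empty_or_nonempty with rfl | ⟨γ, hγ⟩
    · exact ⟨1, one_pos, by simp⟩
    · have hmem : ∀ γ ∈ S, γ.at k ∈ fiber S k 0 := fun γ hγ => ⟨γ, hγ, h0 γ hγ, rfl⟩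
      obtain ⟨d, ⟨δ, hδ, -, rfl⟩, hmin⟩ := (hS.2 k hk 0).exists_isLeast ⟨_, hmem γ hγ⟩
      exact ⟨_, hpos δ hδ, fun γ hγ => hmin (hmem γ hγ)⟩
  have hzero : ∀ γ ∈ AddSubmonoid.closure S, ∀ i < k, γ.at i = 0 := by
    intro γ hγ i hi
    induction hγ using AddSubmonoid.closure_induction with
    | mem x hx => exact h0 x hx i hi
    | zero => rfl
    | add x y _ _ hx hy => simp [hx, hy]
  have hle : ∀ n : ℕ, ∀ γ ∈ n • S, n * d ≤ γ.at k := by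
    intro n
    induction n with
    | zero =>
      intro γ hγ
      rw [zero_nsmul] at hγ
      rw [Set.mem_zero.1 hγ]; simp
    | succ n ih =>
      intro γ hγ
      rw [succ_nsmul] at hγ
      obtain ⟨γ, hγ, δ, hδ, rfl⟩ := hγ
      have := ih γ hγ
      have := hSd δ hδ
      push_cast
      simp only [at_add]
      linarith
  have hbdd : ∀ (M : ℝ), ∃ N : ℕ, ∀ γ ∈ AddSubmonoid.closure S, γ.at k ≤ M →
      γ ∈ ⋃ n ∈ Set.Iic N, n • S := by
    intro M
    obtain ⟨N, hN⟩ := exists_nat_ge (M / d)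
    refine ⟨N, fun γ hγ hM => ?_⟩
    obtain ⟨n, hn⟩ := exists_mem_nsmul_of_mem_closure hγ
    refine Set.mem_iUnion₂.2 ⟨n, ?_, hn⟩
    have h1 := hle n γ hn
    rw [div_le_iff₀ hd] at hN
    have : (n : ℝ) * d ≤ N * d := by linarith
    exact_mod_cast le_of_mul_le_mul_right this hd
  have hT : ∀ N : ℕ, Tame J (⋃ n ∈ Set.Iic N, n • S) := fun N =>
    biUnion (Set.finite_Iic N) fun n _ => hS.nsmul n
  refine ⟨fun γ hγ => ?_, fun l hl β => ?_⟩
  · obtain ⟨n, hn⟩ := exists_mem_nsmul_of_mem_closure hγ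
    exact (hS.nsmul n).1 γ hn
  · intro c
    -- At level `k` the exponent is bounded by `c`; at deeper levels the `k`-th exponent belongs to
    -- the prefix and equals `β.at k`.
    obtain ⟨N, hN⟩ := hbdd (max c (β.at k))
    by_cases hlk : l < k
    · refine (Set.finite_singleton 0).subset ?_
      rintro _ ⟨⟨γ, hγ, -, rfl⟩, -⟩
      exact hzero γ hγ l hlk
    · refine ((hT N).2 l hl β c).subset ?_
      rintro _ ⟨⟨γ, hγ, h, rfl⟩, hc⟩
      refine ⟨⟨γ, hN γ hγ ?_, h, rfl⟩, hc⟩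
      rcases (not_lt.1 hlk).eq_or_lt with rfl | hlt
      · exact le_max_of_le_left hc
      · exact le_max_of_le_right (h k hlt).le

/-- When the exponents before `k` vanish, nonnegativity forces the `k`-th one to be nonnegative. The
part where it is positive is handled by `closure_of_pos`, the part where it is zero by passing to `k
+ 1`, and the monoid generated by a union is the sum of the two monoids. -/
lemma closure (hS : Tame J S) (hnn : ∀ γ ∈ S, 0 ≤ γ) :
    Tame J (AddSubmonoid.closure S : Set Expo) := by
  -- Here `d` counts the levels still to be treated; with none left, `S` is contained in `{0}`.
  suffices H : ∀ d k, k + d = J + 1 → ∀ S, Tame J S → (∀ γ ∈ S, 0 ≤ γ) →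
      (∀ γ ∈ S, ∀ i < k, γ.at i = 0) → Tame J (AddSubmonoid.closure S : Set Expo) from
    H (J + 1) 0 (by omega) S hS hnn (by simp)
  intro d
  induction d with
  | zero =>
    intro k hk S hS _ h0
    have : S ⊆ {0} := fun γ hγ => by
      ext i
      by_cases hi : i < k
      · exact h0 γ hγ i hi
      · exact hS.1 γ hγ i (by omega)
    refine of_subset_singleton (zero_mem _) (γ := 0) ?_
    have := AddSubmonoid.closure_mono this
    rw [AddSubmonoid.closure_singleton_zero] at this
    exact this
  | succ d ih =>
    intro k hk S hS hnn h0
    have h1 := ih (k + 1) (by omega) {γ ∈ S | γ.at k = 0} (hS.mono fun _ h => h.1)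
      (fun γ h => hnn γ h.1) (fun γ h i hi => by
        rcases Nat.lt_succ_iff_lt_or_eq.1 hi with h' | rfl
        · exact h0 γ h.1 i h'
        · exact h.2)
    have h2 := closure_of_pos (S := {γ ∈ S | 0 < γ.at k}) (hS.mono fun _ h => h.1)
      (fun γ h => h0 γ h.1) (by omega) (fun γ h => h.2)
    refine (h1.add h2).mono ?_
    have hSu : S = {γ ∈ S | γ.at k = 0} ∪ {γ ∈ S | 0 < γ.at k} := by
      ext γ
      constructor
      · intro h
        have : (0 : Expo).at k ≤ γ.at k := at_le_of_le (fun i hi => (h0 γ h i hi).symm) (hnn γ h)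
        rcases this.eq_or_lt with h' | h'
        · exact Or.inl ⟨h, h'.symm⟩
        · exact Or.inr ⟨h, h'⟩
      · rintro (h | h) <;> exact h.1
    intro γ hγ
    rw [hSu, SetLike.mem_coe, AddSubmonoid.closure_union, AddSubmonoid.mem_sup] at hγ
    obtain ⟨y, hy, z, hz, rfl⟩ := hγ
    exact Set.add_mem_add hy hz

/-- The exponents are minimized one at a time: a nonempty left-finite fiber has a least element, and
restricting to it fixes one more exponent. After `J + 1` levels one exponent vector remains. -/
lemma exists_isLeast (hS : Tame J S) (hne : S.Nonempty) : ∃ γ, IsLeast S γ := by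
  suffices H : ∀ d k, k + d = J + 1 → ∀ S, Tame J S → S.Nonempty →
      (∀ γ ∈ S, ∀ δ ∈ S, ∀ i < k, γ.at i = δ.at i) → ∃ γ, IsLeast S γ from
    H (J + 1) 0 (by omega) S hS hne (by simp)
  intro d
  induction d with
  | zero =>
    intro k hk S hS ⟨γ, hγ⟩ h0
    refine ⟨γ, hγ, fun δ hδ => le_of_eq ?_⟩
    ext i
    by_cases hi : i < k
    · exact h0 γ hγ δ hδ i hi
    · rw [hS.1 γ hγ i (by omega), hS.1 δ hδ i (by omega)]
  | succ d ih =>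
    intro k hk S hS ⟨γ, hγ⟩ h0
    obtain ⟨a, ⟨δ, hδ, hδγ, rfl⟩, hmin⟩ := (hS.2 k (by omega) γ).exists_isLeast
      ⟨_, γ, hγ, fun _ _ => rfl, rfl⟩
    obtain ⟨m, hm⟩ := ih (k + 1) (by omega) {γ ∈ S | γ.at k = δ.at k} (hS.mono fun _ h => h.1)
      ⟨δ, hδ, rfl⟩ (fun γ hγ γ' hγ' i hi => by
        rcases Nat.lt_succ_iff_lt_or_eq.1 hi with h' | rfl
        · exact h0 γ hγ.1 γ' hγ'.1 i h'
        · exact hγ.2.trans hγ'.2.symm)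
    refine ⟨m, hm.1.1, fun ε hε => ?_⟩
    rcases (hmin ⟨ε, hε, h0 ε hε γ hγ, rfl⟩).eq_or_lt with h | h
    · exact hm.2 ⟨hε, h.symm⟩
    · exact (lt_of_at_lt (h0 m hm.1.1 ε hε) (by rw [hm.1.2]; exact h)).le

lemma isWF (hS : Tame J S) : S.IsWF := by
  rw [Set.IsWF, Set.wellFoundedOn_iff_no_descending_seq]
  intro f hf
  obtain ⟨_, ⟨n, rfl⟩, hmin⟩ := (hS.mono (Set.range_subset_iff.2 hf)).exists_isLeast
    (Set.range_nonempty f)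
  exact absurd (f.map_rel_iff.2 (Nat.lt_succ_self n)) (not_lt.2 (hmin ⟨n + 1, rfl⟩))

lemma isPWO (hS : Tame J S) : S.IsPWO := hS.isWF.isPWO

end Tame

/-- The additive map `β ↦ β + β₀ • o`: the monomials `β` transform so under a substitution of a
monomial with exponent `ell 0 1 + o` for `x`. -/
def shear (o : Expo) : Expo →+ Expo where
  toFun β := β + β.at 0 • o
  map_zero' := by simp
  map_add' β γ := by ext i; simp only [at_add, at_smul]; ring

lemma shear_apply (o β : Expo) : shear o β = β + β.at 0 • o := rfl

lemma shear_at (o β : Expo) (i : ℕ) : (shear o β).at i = β.at i + β.at 0 * o.at i := rfl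

lemma shear_mem_depth {J : ℕ} {o β : Expo} (ho : o ∈ depth J) (hβ : β ∈ depth J) :
    shear o β ∈ depth J := add_mem hβ (Submodule.smul_mem _ _ ho)

/-- The zeroth exponent is multiplied by `1 + o.at 0 > 0`, and vectors with the same zeroth exponent
undergo the same translation. -/
lemma shear_strictMono {o : Expo} (ho : 0 < 1 + o.at 0) : StrictMono (shear o) := by
  intro β γ h
  obtain ⟨k, h1, h2⟩ := lt_iff.1 h
  rcases Nat.eq_zero_or_pos k with rfl | hk
  · refine lt_of_at_lt (k := 0) (by simp) ?_
    simp only [shear_at]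
    nlinarith
  · refine lt_of_at_lt (k := k) (fun i hi => ?_) ?_
    · simp only [shear_at, h1 i hi, h1 0 hk]
    · simp only [shear_at, h1 0 hk]
      linarith

lemma Tame.image_shear {J : ℕ} {S : Set Expo} (hS : Tame J S) {o : Expo} (ho : o ∈ depth J)
    (h0 : 0 < 1 + o.at 0) : Tame J (shear o '' S) := by
  refine ⟨?_, fun k hk β c => ?_⟩
  · rintro _ ⟨γ, hγ, rfl⟩
    exact shear_mem_depth ho (hS.1 γ hγ)
  · rcases Nat.eq_zero_or_pos k with rfl | hk0
    · refine ((hS.2 0 hk 0 (c / (1 + o.at 0))).image fun a => a * (1 + o.at 0)).subset ?_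
      rintro _ ⟨⟨_, ⟨γ, hγ, rfl⟩, -, rfl⟩, hc⟩
      simp only [shear_at, Set.mem_Iic] at hc ⊢
      refine ⟨γ.at 0, ⟨⟨γ, hγ, by simp, rfl⟩, ?_⟩, by simp; ring⟩
      rw [Set.mem_Iic, le_div_iff₀ h0]
      linarith
    -- For `k > 0` the prefix prescribes the zeroth exponent `b` before the shear, so on this fiber
    -- the shear is the translation by `b • o`.
    · set b := β.at 0 / (1 + o.at 0) with hb
      refine ((hS.2 k hk (β - b • o) (c - b * o.at k)).image fun a => a + b * o.at k).subset ?_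
      rintro _ ⟨⟨_, ⟨γ, hγ, rfl⟩, h, rfl⟩, hc⟩
      have hγ0 : γ.at 0 = b := by
        have := h 0 hk0
        rw [hb, eq_div_iff h0.ne', ← this, shear_at]
        ring
      simp only [shear_at, Set.mem_Iic, hγ0] at hc h ⊢
      refine ⟨γ.at k, ⟨⟨γ, hγ, fun i hi => ?_, rfl⟩, ?_⟩, rfl⟩
      · simp [← h i hi]
      · simp only [Set.mem_Iic]; linarith

/-! ### Real powers and logarithms of principal units -/

/-- Series with leading term `1`. -/
def IsPrincipal (U : Series) : Prop := 0 < (U - 1).orderTop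

/-- The power `U ^ b` of a principal unit. -/
def upow (U : Series) (b : ℝ) : Series :=
  PowerSeries.heval (U - 1) (PowerSeries.binomialSeries ℝ b)

/-- The logarithm of a principal unit. -/
def ulog (U : Series) : Series := PowerSeries.heval (U - 1) (PowerSeries.log ℝ)

/-- The monoid generated by the support of `U - 1`. -/
def cone (U : Series) : Set Expo := AddSubmonoid.closure (U - 1).support

lemma isPrincipal_iff {U : Series} : IsPrincipal U ↔ ∀ γ ∈ (U - 1).support, 0 < γ := by
  constructor
  · intro h γ hγ
    by_contra! hle
    exact hγ (coeff_eq_zero_of_lt_orderTop (lt_of_le_of_lt (by exact_mod_cast hle) h))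
  · intro h
    by_cases h0 : U - 1 = 0
    · rw [IsPrincipal, h0]; simp
    · rw [IsPrincipal, zero_lt_orderTop_iff h0]
      exact h _ (by rwa [mem_support, Ne, coeff_order_eq_zero])

lemma isPrincipal_of_forall_le {U : Series} (h : ∀ γ ≤ 0, U.coeff γ = (1 : Series).coeff γ) :
    IsPrincipal U := isPrincipal_iff.2 fun γ hγ => by
  by_contra! hle
  exact hγ (by rw [coeff_sub, h γ hle, sub_self])

lemma IsPrincipal.coeff_of_le {U : Series} (hU : IsPrincipal U) {γ : Expo} (h : γ ≤ 0) :
    U.coeff γ = (1 : Series).coeff γ := by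
  by_contra hne
  have : γ ∈ (U - 1).support := by
    rw [mem_support, coeff_sub]
    exact sub_ne_zero.2 hne
  exact absurd (isPrincipal_iff.1 hU γ this) (not_lt.2 h)

lemma isPrincipal_one : IsPrincipal 1 := by simp [IsPrincipal]

lemma IsPrincipal.isPWO_cone {U : Series} (hU : IsPrincipal U) : (cone U).IsPWO :=
  (isPWO_support _).addSubmonoid_closure fun γ hγ => (isPrincipal_iff.1 hU γ hγ).le

lemma nonneg_of_mem_closure {S : Set Expo} (h : ∀ γ ∈ S, 0 ≤ γ) {γ : Expo}
    (hγ : γ ∈ AddSubmonoid.closure S) : 0 ≤ γ := by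
  induction hγ using AddSubmonoid.closure_induction with
  | mem x hx => exact h x hx
  | zero => exact le_rfl
  | add x y _ _ hx hy => exact add_nonneg hx hy

lemma IsPrincipal.nonneg_of_mem_cone {U : Series} (hU : IsPrincipal U) {γ : Expo}
    (hγ : γ ∈ cone U) : 0 ≤ γ :=
  nonneg_of_mem_closure (fun γ hγ => (isPrincipal_iff.1 hU γ hγ).le) hγ

lemma support_heval_subset (T : Series) (p : PowerSeries ℝ) :
    (PowerSeries.heval T p).support ⊆ AddSubmonoid.closure T.support := by
  intro γ hγ
  have := SummableFamily.support_hsum_subset hγ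
  obtain ⟨n, hn⟩ := Set.mem_iUnion.1 this
  rw [SummableFamily.smulFamily_toFun] at hn
  have hn := support_smul_subset _ _ hn
  rw [SummableFamily.powers_toFun] at hn
  split_ifs at hn with h
  · exact SummableFamily.support_pow_subset_closure _ _ hn
  -- If `T` is not infinitesimal, its powers are replaced by those of `0`, and only the exponent `0`
  -- can survive.
  · have := SummableFamily.support_pow_subset_closure _ _ hn
    rw [support_zero, AddSubmonoid.closure_empty] at this
    exact AddSubmonoid.mem_bot.1 this ▸ zero_mem _

lemma support_upow_subset (U : Series) (b : ℝ) : (upow U b).support ⊆ cone U :=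
  support_heval_subset _ _

lemma support_ulog_subset (U : Series) : (ulog U).support ⊆ cone U :=
  support_heval_subset _ _

lemma upow_add (U : Series) (a b : ℝ) : upow U (a + b) = upow U a * upow U b := by
  simp only [upow, PowerSeries.binomialSeries_add, map_mul]

lemma upow_natCast {U : Series} (hU : IsPrincipal U) (n : ℕ) : upow U n = U ^ n := by
  rw [upow, PowerSeries.binomialSeries_nat, map_pow, map_add, map_one, PowerSeries.heval_X _ hU]
  congr 1; ring

@[simp] lemma upow_zero (U : Series) : upow U 0 = 1 := by
  rw [upow, PowerSeries.binomialSeries_zero, map_one]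

@[simp] lemma upow_one {U : Series} (hU : IsPrincipal U) : upow U 1 = U := by
  simpa using upow_natCast hU 1

/-- The index set depends on `T` and `γ` but not on `p`. Hence a coefficient of `(1 + T) ^ b` is a
fixed finite combination of binomials in `b`, that is, a polynomial in `b`. -/
lemma coeff_heval_eq_sum {T : Series} (hT : 0 < T.orderTop) (γ : Expo) :
    ∃ s : Finset ℕ, ∀ p : PowerSeries ℝ,
      (PowerSeries.heval T p).coeff γ = ∑ n ∈ s, p.coeff n * (T ^ n).coeff γ := by
  refine ⟨(SummableFamily.pow_finite_co_support hT γ).toFinset, fun p => ?_⟩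
  rw [PowerSeries.heval_apply, SummableFamily.coeff_hsum]
  have : ∀ n, (SummableFamily.powerSeriesFamily T p n).coeff γ = p.coeff n * (T ^ n).coeff γ := by
    intro n
    rw [SummableFamily.powerSeriesFamily_of_orderTop_pos hT]; rfl
  simp only [this]
  refine finsum_eq_sum_of_support_subset _ fun n hn => ?_
  simp only [Set.Finite.coe_toFinset, Set.mem_ofPred_eq]
  exact right_ne_zero_of_mul hn

lemma heval_eq_add (T : Series) (hT : 0 < T.orderTop) (p : PowerSeries ℝ) :
    PowerSeries.heval T p = C (p.coeff 0) + C (p.coeff 1) * T +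
      T * T * PowerSeries.heval T (PowerSeries.mk fun n => p.coeff (n + 2)) := by
  have hp : p = PowerSeries.C (p.coeff 0) + PowerSeries.C (p.coeff 1) * PowerSeries.X +
      PowerSeries.X ^ 2 * PowerSeries.mk fun n => p.coeff (n + 2) := by
    ext n
    rcases n with _ | _ | n
    · simp
    · simp [PowerSeries.coeff_X_pow_mul', PowerSeries.coeff_C]
    · simp [PowerSeries.coeff_X_pow_mul']
  conv_lhs => rw [hp]
  have hC : ∀ r : ℝ, PowerSeries.heval T (PowerSeries.C r) = C r := fun r => by
    rw [PowerSeries.heval_C, ← C_mul_eq_smul, mul_one]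
  rw [map_add, map_add, map_mul, map_mul, map_pow, PowerSeries.heval_X _ hT, hC, hC, sq]

/-! ### Families with coefficients polynomial in the exponent -/

/-- `F b` has supports in a common partially well-ordered set, its coefficients are polynomials in
`b`, and `D` is its derivative at `b = 0`. -/
structure PolyFamily (F : ℝ → Series) (D : Series) : Prop where
  exists_isPWO : ∃ A : Set Expo, A.IsPWO ∧ ∀ b, (F b).support ⊆ A
  exists_poly : ∀ γ, ∃ P : Polynomial ℝ, (∀ b, (F b).coeff γ = P.eval b) ∧
    P.derivative.eval 0 = D.coeff γ

namespace PolyFamily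

variable {F G : ℝ → Series} {D E : Series}

/-- A real polynomial is determined by its values at the natural numbers. Laws of `upow` thus reduce
to laws of ordinary powers, and comparing derivatives at `0` yields the matching laws of `ulog` for
free. -/
lemma ext_nat (hF : PolyFamily F D) (hG : PolyFamily G E) (h : ∀ n : ℕ, F n = G n) :
    F = G ∧ D = E := by
  have key : ∀ γ, (∀ b, (F b).coeff γ = (G b).coeff γ) ∧ D.coeff γ = E.coeff γ := by
    intro γ
    obtain ⟨P, hP, hP'⟩ := hF.exists_poly γ
    obtain ⟨Q, hQ, hQ'⟩ := hG.exists_poly γ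
    have hPQ : P = Q := by
      refine Polynomial.eq_of_infinite_eval_eq P Q
        ((Set.infinite_range_of_injective (Nat.cast_injective (R := ℝ))).mono ?_)
      rintro _ ⟨n, rfl⟩
      change P.eval (n : ℝ) = Q.eval (n : ℝ)
      rw [← hP, ← hQ, h]
    subst hPQ
    exact ⟨fun b => by rw [hP, hQ], by rw [← hP', ← hQ']⟩
  exact ⟨funext fun b => HahnSeries.ext (funext fun γ => (key γ).1 b),
    HahnSeries.ext (funext fun γ => (key γ).2)⟩

lemma mul (hF : PolyFamily F D) (hG : PolyFamily G E) :
    PolyFamily (fun b => F b * G b) (D * G 0 + F 0 * E) := by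
  obtain ⟨A, hA, hFA⟩ := hF.exists_isPWO
  obtain ⟨B, hB, hGB⟩ := hG.exists_isPWO
  have hsub : ∀ {H : ℝ → Series} {K : Series} {A : Set Expo}, PolyFamily H K →
      (∀ b, (H b).support ⊆ A) → K.support ⊆ A := by
    intro H K A hH hHA γ hγ
    by_contra hn
    obtain ⟨P, hP, hP'⟩ := hH.exists_poly γ
    have : P = 0 := by
      refine Polynomial.funext fun b => ?_
      rw [← hP, Polynomial.eval_zero]
      by_contra hne
      exact hn (hHA b hne)
    rw [this] at hP'
    exact hγ (by simpa using hP'.symm)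
  refine ⟨⟨A + B, hA.add hB, fun b => (support_mul_subset).trans
    (Set.add_subset_add (hFA b) (hGB b))⟩, fun γ => ?_⟩
  choose P hP hP' using hF.exists_poly
  choose Q hQ hQ' using hG.exists_poly
  -- Expanding over the antidiagonal of the common supports `A` and `B` makes the index set
  -- independent of `b`, so that the coefficient of the product is visibly a polynomial.
  have hmul : ∀ {X Y : Series}, X.support ⊆ A → Y.support ⊆ B →
      (X * Y).coeff γ = ∑ ij ∈ Finset.antidiagonal hA hB γ, X.coeff ij.1 * Y.coeff ij.2 := by
    intro X Y hX hY
    rw [coeff_mul_left' hA hX]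
    refine Finset.sum_subset ?_ ?_
    · intro ij hij
      rw [Finset.mem_antidiagonal] at hij ⊢
      exact ⟨hij.1, hY hij.2.1, hij.2.2⟩
    · intro ij hij hn
      rw [Finset.mem_antidiagonal] at hij hn
      by_contra hne
      exact hn ⟨hij.1, right_ne_zero_of_mul hne, hij.2.2⟩
  refine ⟨∑ ij ∈ Finset.antidiagonal hA hB γ, P ij.1 * Q ij.2, fun b => ?_, ?_⟩
  · rw [hmul (hFA b) (hGB b), Polynomial.eval_finsetSum]
    exact Finset.sum_congr rfl fun ij _ => by rw [Polynomial.eval_mul, hP, hQ]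
  · rw [coeff_add, hmul (hsub hF hFA) (hGB 0), hmul (hFA 0) (hsub hG hGB),
      Polynomial.derivative_sum, Polynomial.eval_finsetSum, ← Finset.sum_add_distrib]
    refine Finset.sum_congr rfl fun ij _ => ?_
    simp only [Polynomial.derivative_mul, Polynomial.eval_add, Polynomial.eval_mul, hP', hQ', hP, hQ]

lemma comp_mul (hF : PolyFamily F D) (a : ℝ) : PolyFamily (fun b => F (a * b)) (a • D) := by
  obtain ⟨A, hA, hFA⟩ := hF.exists_isPWO
  refine ⟨⟨A, hA, fun b => hFA _⟩, fun γ => ?_⟩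
  obtain ⟨P, hP, hP'⟩ := hF.exists_poly γ
  refine ⟨P.comp (Polynomial.C a * Polynomial.X), fun b => by simp [hP], ?_⟩
  simp [Polynomial.derivative_comp, hP']

end PolyFamily

/-- The polynomial `b ↦ b choose n`. -/
def choosePoly (n : ℕ) : Polynomial ℝ := Polynomial.C (n.factorial : ℝ)⁻¹ * descPochhammer ℝ n

lemma eval_choosePoly (n : ℕ) (b : ℝ) : (choosePoly n).eval b = Ring.choose b n := by
  rw [Ring.choose_eq_smul, choosePoly, Polynomial.eval_mul, Polynomial.eval_C, smul_eq_mul,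
    ← descPochhammer_map (algebraMap ℤ ℝ), Polynomial.eval_map_algebraMap,
    Polynomial.aeval_eq_smeval]

/-- The polynomial `b choose n` is `b` times a cofactor, so its derivative at `0` is the value of
the cofactor there. This is the coefficientwise form of the fact that `(1 + T) ^ b` has derivative
`log (1 + T)` at `b = 0`. -/
lemma eval_derivative_choosePoly (n : ℕ) :
    (choosePoly n).derivative.eval 0 = (PowerSeries.log ℝ).coeff n := by
  rcases n with _ | n
  · simp [choosePoly]
  · have h1 : ∀ n : ℕ, (descPochhammer ℝ n).eval (-1) = (-1) ^ n * n.factorial := by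
      intro n
      induction n with
      | zero => simp
      | succ n ih =>
        rw [descPochhammer_succ_right, Polynomial.eval_mul, ih, Nat.factorial_succ]
        simp only [Polynomial.eval_sub, Polynomial.eval_X, Polynomial.eval_natCast]
        push_cast; ring
    have h2 : (n.factorial : ℝ) ≠ 0 := by positivity
    have h3 : ((n : ℝ) + 1) ≠ 0 := by positivity
    simp only [choosePoly, descPochhammer_succ_left, Polynomial.derivative_mul, Polynomial.derivative_X, one_mul, Polynomial.eval_mul,
      Polynomial.eval_C, Polynomial.eval_add, Polynomial.eval_X, zero_mul, add_zero,
      Polynomial.eval_comp, Polynomial.eval_sub, Polynomial.eval_one, zero_sub, h1,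
      PowerSeries.coeff_log, Nat.factorial_succ]
    simp
    field_simp
    ring

lemma polyFamily_upow {U : Series} (hU : IsPrincipal U) : PolyFamily (upow U) (ulog U) := by
  refine ⟨⟨cone U, hU.isPWO_cone, support_upow_subset U⟩, fun γ => ?_⟩
  obtain ⟨s, hs⟩ := coeff_heval_eq_sum hU γ
  refine ⟨∑ n ∈ s, choosePoly n * Polynomial.C (((U - 1) ^ n).coeff γ), fun b => ?_, ?_⟩
  · rw [upow, hs, Polynomial.eval_finsetSum]
    refine Finset.sum_congr rfl fun n _ => ?_
    rw [PowerSeries.binomialSeries_coeff, Polynomial.eval_mul, Polynomial.eval_C, eval_choosePoly]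
    simp
  · rw [ulog, hs, Polynomial.derivative_sum, Polynomial.eval_finsetSum]
    refine Finset.sum_congr rfl fun n _ => ?_
    simp [Polynomial.derivative_mul, eval_derivative_choosePoly]

lemma coeff_heval_of_le {T : Series} (hT : 0 < T.orderTop) (p : PowerSeries ℝ) {γ : Expo}
    (h : γ ≤ 0) : (PowerSeries.heval T p).coeff γ = (C p.constantCoeff : Series).coeff γ := by
  by_cases h0 : γ = 0
  · rw [h0, PowerSeries.coeff_heval_zero]; simp [C_apply]
  · rw [C_apply, coeff_single_of_ne h0]
    by_contra hne
    have hT' : IsPrincipal (1 + T) := by simpa [IsPrincipal] using hT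
    have : 0 ≤ γ := hT'.nonneg_of_mem_cone (by
      have := support_heval_subset T p hne
      simpa [cone] using this)
    exact h0 (le_antisymm h this)

lemma IsPrincipal.upow {U : Series} (hU : IsPrincipal U) (b : ℝ) : IsPrincipal (upow U b) :=
  isPrincipal_of_forall_le fun γ h => by
    rw [Transseries.upow, coeff_heval_of_le hU _ h, PowerSeries.binomialSeries_constantCoeff, C_one]

lemma IsPrincipal.mul {U V : Series} (hU : IsPrincipal U) (hV : IsPrincipal V) :
    IsPrincipal (U * V) := by
  have h : U * V - 1 = (U - 1) * (V - 1) + ((U - 1) + (V - 1)) := by ring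
  rw [isPrincipal_iff] at hU hV ⊢
  intro γ hγ
  rw [h] at hγ
  rcases support_add_subset _ _ hγ with hγ | hγ
  · obtain ⟨a, ha, b, hb, rfl⟩ := support_mul_subset hγ
    exact add_pos (hU a ha) (hV b hb)
  · exact (support_add_subset _ _ hγ).elim (hU γ) (hV γ)

lemma IsPrincipal.ne_zero {U : Series} (hU : IsPrincipal U) : U ≠ 0 := by
  rintro rfl
  have := hU.coeff_of_le (le_refl 0)
  simp at this

lemma upow_mul_ulog {U V : Series} (hU : IsPrincipal U) (hV : IsPrincipal V) :
    (upow (U * V) = fun b => upow U b * upow V b) ∧ ulog (U * V) = ulog U + ulog V := by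
  have := (polyFamily_upow (hU.mul hV)).ext_nat ((polyFamily_upow hU).mul (polyFamily_upow hV))
    fun n => by rw [upow_natCast (hU.mul hV), upow_natCast hU, upow_natCast hV, mul_pow]
  simpa [upow_zero] using this

lemma upow_mul {U V : Series} (hU : IsPrincipal U) (hV : IsPrincipal V) (b : ℝ) :
    upow (U * V) b = upow U b * upow V b := congrFun (upow_mul_ulog hU hV).1 b

lemma ulog_mul {U V : Series} (hU : IsPrincipal U) (hV : IsPrincipal V) :
    ulog (U * V) = ulog U + ulog V := (upow_mul_ulog hU hV).2

lemma upow_upow_ulog {U : Series} (hU : IsPrincipal U) (a : ℝ) :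
    (upow (upow U a) = fun b => upow U (a * b)) ∧ ulog (upow U a) = a • ulog U := by
  refine (polyFamily_upow (hU.upow a)).ext_nat ((polyFamily_upow hU).comp_mul a) fun n => ?_
  rw [upow_natCast (hU.upow a)]
  induction n with
  | zero => simp
  | succ n ih => rw [pow_succ, ih, ← upow_add]; push_cast; congr 1; ring

lemma upow_upow {U : Series} (hU : IsPrincipal U) (a b : ℝ) :
    upow (upow U a) b = upow U (a * b) := congrFun (upow_upow_ulog hU a).1 b

lemma ulog_upow {U : Series} (hU : IsPrincipal U) (a : ℝ) : ulog (upow U a) = a • ulog U :=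
  (upow_upow_ulog hU a).2

lemma ulog_one : ulog 1 = 0 := by
  have := ulog_mul isPrincipal_one isPrincipal_one
  simpa using this

lemma upow_one_left (b : ℝ) : upow 1 b = 1 := by
  have := upow_mul isPrincipal_one isPrincipal_one b
  rw [one_mul] at this
  exact (mul_eq_left₀ (isPrincipal_one.upow b).ne_zero).1 this.symm

lemma coeff_ulog_of_le {U : Series} (hU : IsPrincipal U) {γ : Expo} (h : γ ≤ 0) :
    (ulog U).coeff γ = 0 := by
  rw [ulog, coeff_heval_of_le hU _ h]; simp

/-! ### Real powers and logarithms of positive series -/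

/-- The principal unit `1 + T` in `φ = c * m * (1 + T)`. -/
def unitPart (φ : Series) : Series := single (-φ.order) (φ.leadingCoeff)⁻¹ * φ

/-- The logarithm of a monomial. -/
def logMono (o : Expo) : Series := (ofLex o).sum fun i a => ellPow (i + 1) (-1) (-a)

lemma single_mul_unitPart {φ : Series} (h : φ ≠ 0) :
    single φ.order φ.leadingCoeff * unitPart φ = φ := by
  rw [unitPart, ← mul_assoc, single_mul_single, add_neg_cancel,
    mul_inv_cancel₀ (leadingCoeff_ne_zero.2 h), single_zero_one, one_mul]

lemma isPrincipal_unitPart {φ : Series} (h : φ ≠ 0) : IsPrincipal (unitPart φ) := by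
  refine isPrincipal_of_forall_le fun γ hγ => ?_
  rw [unitPart, coeff_single_mul, coeff_one, sub_neg_eq_add]
  rcases hγ.eq_or_lt with rfl | hlt
  · rw [zero_add, ← leadingCoeff_eq, if_pos rfl, inv_mul_cancel₀ (leadingCoeff_ne_zero.2 h)]
  · rw [if_neg hlt.ne, coeff_eq_zero_of_lt_order, mul_zero]
    simpa using hlt

section

variable {o : Expo} {c : ℝ} {U : Series}

lemma orderTop_of_isPrincipal (hU : IsPrincipal U) : U.orderTop = 0 := by
  have h0 := hU.coeff_of_le (le_refl 0)
  rw [coeff_one, if_pos rfl] at h0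
  refine orderTop_eq_of_le (g := (0 : Expo)) (by rw [mem_support, h0]; exact one_ne_zero)
    fun γ hγ => ?_
  by_contra! hlt
  rw [mem_support, hU.coeff_of_le hlt.le, coeff_one, if_neg hlt.ne] at hγ
  exact hγ rfl

lemma order_of_isPrincipal (hU : IsPrincipal U) : U.order = 0 := by
  have := order_eq_orderTop_of_ne_zero hU.ne_zero
  rw [orderTop_of_isPrincipal hU] at this
  exact_mod_cast this

lemma order_single_mul (hc : c ≠ 0) (hU : IsPrincipal U) : (single o c * U).order = o := by
  rw [order_mul (single_ne_zero hc) hU.ne_zero, order_single hc, order_of_isPrincipal hU, add_zero]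

lemma leadingCoeff_single_mul (hU : IsPrincipal U) :
    (single o c * U).leadingCoeff = c := by
  have h0 := hU.coeff_of_le (le_refl 0)
  rw [coeff_one, if_pos rfl] at h0
  rw [leadingCoeff_mul, leadingCoeff_of_single, leadingCoeff_eq (x := U), order_of_isPrincipal hU,
    h0, mul_one]

lemma unitPart_single_mul (hc : c ≠ 0) (hU : IsPrincipal U) : unitPart (single o c * U) = U := by
  rw [unitPart, order_single_mul hc hU, leadingCoeff_single_mul hU, ← mul_assoc, single_mul_single,
    neg_add_cancel, inv_mul_cancel₀ hc, single_zero_one, one_mul]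

lemma rpow_single_mul (hc : c ≠ 0) (hU : IsPrincipal U) (a : ℝ) :
    rpow (single o c * U) a = single (a • o) (c ^ a) * upow U a := by
  change single (a • (single o c * U).order) ((single o c * U).leadingCoeff ^ a) *
    upow (unitPart (single o c * U)) a = _
  rw [order_single_mul hc hU, leadingCoeff_single_mul hU, unitPart_single_mul hc hU]

lemma log_single_mul (hc : c ≠ 0) (hU : IsPrincipal U) :
    log (single o c * U) = C (Real.log c) + logMono o + ulog U := by
  change C (Real.log (single o c * U).leadingCoeff) + logMono (single o c * U).order +
    ulog (unitPart (single o c * U)) = _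
  rw [order_single_mul hc hU, leadingCoeff_single_mul hU, unitPart_single_mul hc hU]

end

lemma logMono_add (o o' : Expo) : logMono (o + o') = logMono o + logMono o' := by
  refine Finsupp.sum_add_index' (fun i => ?_) fun i a b => ?_
  · simp [ellPow]
  · simp [ellPow, neg_add_rev, add_comm]

lemma logMono_smul (a : ℝ) (o : Expo) : logMono (a • o) = a • logMono o := by
  change Finsupp.sum (a • ofLex o) _ = a • Finsupp.sum (ofLex o) _
  rw [Finsupp.sum_smul_index' (fun i => by simp [ellPow]), Finsupp.smul_sum]
  refine Finset.sum_congr rfl fun i _ => ?_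
  simp only [ellPow, smul_eq_mul, ← C_mul_eq_smul, C_apply, single_mul_single, zero_add]
  rw [mul_neg]

lemma logMono_ell (i : ℕ) (a : ℝ) : logMono (ell i a) = ellPow (i + 1) (-1) (-a) :=
  Finsupp.sum_single_index (by simp [ellPow])

lemma logMono_zero : logMono 0 = 0 := Finsupp.sum_zero_index

/-- Every positive series is `c * m * U` with `c > 0` and a principal unit `U`. -/
lemma exists_eq_single_mul {φ : Series} (h : 0 < φ.leadingCoeff) :
    ∃ c U, 0 < c ∧ IsPrincipal U ∧ φ = single φ.order c * U :=
  have h0 : φ ≠ 0 := leadingCoeff_ne_zero.1 h.ne'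
  ⟨_, _, h, isPrincipal_unitPart h0, (single_mul_unitPart h0).symm⟩

lemma mul_single_mul (o o' : Expo) (c c' : ℝ) (U V : Series) :
    single o c * U * (single o' c' * V) = single (o + o') (c * c') * (U * V) := by
  rw [← single_mul_single]; ring

lemma leadingCoeff_rpow_pos {φ : Series} (h : 0 < φ.leadingCoeff) (a : ℝ) :
    0 < (rpow φ a).leadingCoeff := by
  obtain ⟨c, U, hc, hU, h⟩ := exists_eq_single_mul h
  rw [h, rpow_single_mul hc.ne' hU, leadingCoeff_single_mul (hU.upow a)]
  positivity

lemma rpow_mul {φ ψ : Series} (hφ : 0 < φ.leadingCoeff) (hψ : 0 < ψ.leadingCoeff) (a : ℝ) :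
    rpow (φ * ψ) a = rpow φ a * rpow ψ a := by
  obtain ⟨c, U, hc, hU, h⟩ := exists_eq_single_mul hφ
  obtain ⟨d, V, hd, hV, h'⟩ := exists_eq_single_mul hψ
  rw [h, h', mul_single_mul, rpow_single_mul (by positivity) (hU.mul hV),
    rpow_single_mul hc.ne' hU, rpow_single_mul hd.ne' hV, mul_single_mul, upow_mul hU hV,
    Real.mul_rpow hc.le hd.le, smul_add]

lemma log_mul {φ ψ : Series} (hφ : 0 < φ.leadingCoeff) (hψ : 0 < ψ.leadingCoeff) :
    log (φ * ψ) = log φ + log ψ := by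
  obtain ⟨c, U, hc, hU, h⟩ := exists_eq_single_mul hφ
  obtain ⟨d, V, hd, hV, h'⟩ := exists_eq_single_mul hψ
  rw [h, h', mul_single_mul, log_single_mul (by positivity) (hU.mul hV),
    log_single_mul hc.ne' hU, log_single_mul hd.ne' hV, ulog_mul hU hV,
    Real.log_mul hc.ne' hd.ne', logMono_add, map_add]
  ring

lemma rpow_rpow {φ : Series} (hφ : 0 < φ.leadingCoeff) (a b : ℝ) :
    rpow (rpow φ a) b = rpow φ (a * b) := by
  obtain ⟨c, U, hc, hU, h⟩ := exists_eq_single_mul hφ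
  rw [h, rpow_single_mul hc.ne' hU, rpow_single_mul (by positivity) (hU.upow a), upow_upow hU,
    rpow_single_mul hc.ne' hU, smul_smul, ← Real.rpow_mul hc.le, mul_comm b a]

lemma log_rpow {φ : Series} (hφ : 0 < φ.leadingCoeff) (a : ℝ) :
    log (rpow φ a) = a • log φ := by
  obtain ⟨c, U, hc, hU, h⟩ := exists_eq_single_mul hφ
  rw [h, rpow_single_mul hc.ne' hU, log_single_mul (by positivity) (hU.upow a), ulog_upow hU,
    log_single_mul hc.ne' hU, logMono_smul, Real.log_rpow hc, smul_add, smul_add, map_mul,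
    C_mul_eq_smul]

lemma rpow_add {φ : Series} (hφ : 0 < φ.leadingCoeff) (a b : ℝ) :
    rpow φ (a + b) = rpow φ a * rpow φ b := by
  obtain ⟨c, U, hc, hU, h⟩ := exists_eq_single_mul hφ
  rw [h, rpow_single_mul hc.ne' hU, rpow_single_mul hc.ne' hU, rpow_single_mul hc.ne' hU,
    mul_single_mul, upow_add, Real.rpow_add hc, Expo.add_smul]

lemma rpow_zero' {φ : Series} (hφ : 0 < φ.leadingCoeff) : rpow φ 0 = 1 := by
  obtain ⟨c, U, hc, hU, h⟩ := exists_eq_single_mul hφ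
  rw [h, rpow_single_mul hc.ne' hU, upow_zero, zero_smul, Real.rpow_zero, single_zero_one, one_mul]

lemma rpow_one' {φ : Series} (hφ : 0 < φ.leadingCoeff) : rpow φ 1 = φ := by
  obtain ⟨c, U, hc, hU, h⟩ := exists_eq_single_mul hφ
  rw [h, rpow_single_mul hc.ne' hU, upow_one hU, one_smul, Real.rpow_one]

lemma rpow_neg_one {φ : Series} (hφ : 0 < φ.leadingCoeff) : rpow φ (-1) = φ⁻¹ := by
  refine eq_inv_of_mul_eq_one_left ?_
  nth_rw 2 [← rpow_one' hφ]
  rw [← rpow_add hφ, neg_add_cancel, rpow_zero' hφ]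

lemma order_rpow {φ : Series} (hφ : 0 < φ.leadingCoeff) (a : ℝ) :
    (rpow φ a).order = a • φ.order := by
  obtain ⟨c, U, hc, hU, h⟩ := exists_eq_single_mul hφ
  rw [h, rpow_single_mul hc.ne' hU, order_single_mul (by positivity) (hU.upow a),
    order_single_mul hc.ne' hU]

lemma rpow_single {o : Expo} {c : ℝ} (hc : 0 < c) (a : ℝ) :
    rpow (single o c) a = single (a • o) (c ^ a) := by
  have := rpow_single_mul (o := o) hc.ne' isPrincipal_one a
  rwa [mul_one, upow_one_left, mul_one] at this

lemma log_single {o : Expo} {c : ℝ} (hc : 0 < c) :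
    log (single o c) = C (Real.log c) + logMono o := by
  have := log_single_mul (o := o) hc.ne' isPrincipal_one
  rwa [mul_one, ulog_one, add_zero] at this

lemma log_one : log 1 = 0 := by
  have := log_single (o := 0) one_pos
  rwa [single_zero_one, Real.log_one, map_zero, logMono_zero, add_zero] at this

lemma leadingCoeff_prod {ι : Type*} (s : Finset ι) (F : ι → Series) :
    (∏ i ∈ s, F i).leadingCoeff = ∏ i ∈ s, (F i).leadingCoeff := by
  classical
  induction s using Finset.induction_on with
  | empty => simp
  | insert i s hi ih => rw [Finset.prod_insert hi, Finset.prod_insert hi, leadingCoeff_mul, ih]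

lemma leadingCoeff_prod_pos {ι : Type*} {s : Finset ι} {F : ι → Series}
    (h : ∀ i ∈ s, 0 < (F i).leadingCoeff) : 0 < (∏ i ∈ s, F i).leadingCoeff := by
  rw [leadingCoeff_prod]
  exact Finset.prod_pos h

lemma rpow_prod {ι : Type*} {s : Finset ι} {F : ι → Series}
    (h : ∀ i ∈ s, 0 < (F i).leadingCoeff) (a : ℝ) :
    rpow (∏ i ∈ s, F i) a = ∏ i ∈ s, rpow (F i) a := by
  classical
  induction s using Finset.induction_on with
  | empty => simpa [single_zero_one] using rpow_single (o := 0) one_pos a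
  | insert i s hi ih =>
    rw [Finset.forall_mem_insert] at h
    rw [Finset.prod_insert hi, Finset.prod_insert hi, rpow_mul h.1 (leadingCoeff_prod_pos h.2),
      ih h.2]

lemma log_prod {ι : Type*} {s : Finset ι} {F : ι → Series}
    (h : ∀ i ∈ s, 0 < (F i).leadingCoeff) : log (∏ i ∈ s, F i) = ∑ i ∈ s, log (F i) := by
  classical
  induction s using Finset.induction_on with
  | empty => simpa using log_one
  | insert i s hi ih =>
    rw [Finset.forall_mem_insert] at h
    rw [Finset.prod_insert hi, Finset.sum_insert hi, log_mul h.1 (leadingCoeff_prod_pos h.2),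
      ih h.2]

/-! ### The field operations and `L_J^∞` -/

namespace LInf

variable {J : ℕ} {F G : Series}

lemma of_subset {S : Set Expo} (hS : Tame J S) (h : F.support ⊆ S) : F ∈ LInf J := Tame.mono hS h

lemma mono {J' : ℕ} (h : J ≤ J') (hF : F ∈ LInf J) : F ∈ LInf J' := Tame.mono_depth h hF

lemma single_mem {o : Expo} (ho : o ∈ depth J) (c : ℝ) : single o c ∈ LInf J :=
  of_subset (Tame.singleton ho) support_single_subset

lemma C_mem (c : ℝ) : C c ∈ LInf J := single_mem (zero_mem _) c

lemma one_mem : (1 : Series) ∈ LInf J := C_one (Γ := Expo) (R := ℝ) ▸ C_mem 1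

lemma zero_mem : (0 : Series) ∈ LInf J := of_subset Tame.empty (by simp)

lemma add_mem (hF : F ∈ LInf J) (hG : G ∈ LInf J) : F + G ∈ LInf J :=
  of_subset (Tame.union hF hG) (support_add_subset _ _)

lemma neg_mem (hF : F ∈ LInf J) : -F ∈ LInf J := of_subset hF (support_neg_subset _)

lemma sub_mem (hF : F ∈ LInf J) (hG : G ∈ LInf J) : F - G ∈ LInf J :=
  of_subset (Tame.union hF hG) (support_sub_subset _ _)

lemma smul_mem (c : ℝ) (hF : F ∈ LInf J) : c • F ∈ LInf J :=
  of_subset hF (support_smul_subset _ _)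

lemma mul_mem (hF : F ∈ LInf J) (hG : G ∈ LInf J) : F * G ∈ LInf J :=
  of_subset (Tame.add hF hG) support_mul_subset

lemma prod_mem {ι : Type*} {s : Finset ι} {f : ι → Series} (h : ∀ i ∈ s, f i ∈ LInf J) :
    ∏ i ∈ s, f i ∈ LInf J := by
  classical
  induction s using Finset.induction_on with
  | empty => simpa using one_mem
  | insert i s hi ih =>
    rw [Finset.forall_mem_insert] at h
    rw [Finset.prod_insert hi]
    exact mul_mem h.1 (ih h.2)

lemma order_mem (hF : F ∈ LInf J) : F.order ∈ depth J := by
  by_cases h : F = 0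
  · rw [h, order_zero]; exact Submodule.zero_mem _
  · exact hF.1 _ (by rwa [mem_support, Ne, coeff_order_eq_zero])

lemma tame_cone (hU : IsPrincipal F) (hF : F ∈ LInf J) : Tame J (cone F) :=
  Tame.closure (sub_mem hF one_mem) fun γ hγ => (isPrincipal_iff.1 hU γ hγ).le

lemma upow_mem (hU : IsPrincipal F) (hF : F ∈ LInf J) (b : ℝ) : upow F b ∈ LInf J :=
  of_subset (tame_cone hU hF) (support_upow_subset F b)

lemma ulog_mem (hU : IsPrincipal F) (hF : F ∈ LInf J) : ulog F ∈ LInf J :=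
  of_subset (tame_cone hU hF) (support_ulog_subset F)

lemma unitPart_mem (hF : F ∈ LInf J) : unitPart F ∈ LInf J :=
  mul_mem (single_mem (Submodule.neg_mem _ (order_mem hF)) _) hF

lemma rpow_mem (hF : F ∈ LInf J) (h : 0 < F.leadingCoeff) (a : ℝ) : rpow F a ∈ LInf J :=
  mul_mem (single_mem (Submodule.smul_mem _ a (order_mem hF)) _)
    (upow_mem (isPrincipal_unitPart (leadingCoeff_ne_zero.1 h.ne')) (unitPart_mem hF) a)

lemma inv_mem (hF : F ∈ LInf J) (h : 0 < F.leadingCoeff) : F⁻¹ ∈ LInf J :=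
  rpow_neg_one h ▸ rpow_mem hF h (-1)

/-- The logarithm of `ℓ_i` is `-ℓ_{i+1}⁻¹`, one level deeper; this is why the exponents must stop
strictly before `J`. -/
lemma logMono_mem {o : Expo} (ho : ∀ i, J ≤ i → o.at i = 0) : logMono o ∈ LInf J := by
  classical
  have : ∀ s : Finset ℕ, (∀ i ∈ s, i < J) →
      ∑ i ∈ s, ellPow (i + 1) (-1) (-(ofLex o i)) ∈ LInf J := by
    intro s
    induction s using Finset.induction_on with
    | empty => intro _; simpa using zero_mem
    | insert i s hi ih =>
      intro h
      rw [Finset.forall_mem_insert] at h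
      rw [Finset.sum_insert hi]
      exact add_mem (single_mem (ell_mem_depth h.1 _) _) (ih h.2)
  refine this _ fun i hi => ?_
  by_contra! hle
  exact (Finsupp.mem_support_iff.1 hi) (ho i hle)

lemma log_mem (hF : F ∈ LInf J) (h : 0 < F.leadingCoeff)
    (ho : ∀ i, J ≤ i → F.order.at i = 0) : log F ∈ LInf J :=
  add_mem (add_mem (C_mem _) (logMono_mem ho))
    (ulog_mem (isPrincipal_unitPart (leadingCoeff_ne_zero.1 h.ne')) (unitPart_mem hF))

end LInf

/-! ### Strongly linear maps -/

lemma zero_smul_series (F : Series) : (0 : ℝ) • F = 0 := by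
  rw [← C_mul_eq_smul, map_zero, zero_mul]

lemma add_smul_series (a b : ℝ) (F : Series) : (a + b) • F = a • F + b • F := by
  simp only [← C_mul_eq_smul, map_add, add_mul]

lemma sub_smul_series (a b : ℝ) (F : Series) : (a - b) • F = a • F - b • F := by
  simp only [← C_mul_eq_smul, map_sub, sub_mul]

/-- The families `(ψ_β * K_β)_β` are summable for all series `ψ`. -/
def IsKernel (K : Expo → Series) : Prop :=
  ∀ A : Set Expo, A.IsPWO → (⋃ β ∈ A, (K β).support).IsPWO ∧
    ∀ γ, {β | β ∈ A ∧ (K β).coeff γ ≠ 0}.Finite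

/-- The summable family `(ψ_β * K_β)_β`. -/
def kernelFamily {K : Expo → Series} (hK : IsKernel K) (ψ : Series) :
    SummableFamily Expo ℝ Expo where
  toFun β := ψ.coeff β • K β
  isPWO_iUnion_support' := by
    refine (hK ψ.support ψ.isPWO_support).1.mono (Set.iUnion_subset fun β γ hγ => ?_)
    rw [mem_support, coeff_smul] at hγ
    exact Set.mem_iUnion₂.2 ⟨β, left_ne_zero_of_smul hγ, right_ne_zero_of_smul hγ⟩
  finite_co_support' γ := by
    refine ((hK ψ.support ψ.isPWO_support).2 γ).subset fun β hβ => ?_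
    rw [Set.mem_ofPred_eq, coeff_smul] at hβ
    exact ⟨left_ne_zero_of_smul hβ, right_ne_zero_of_smul hβ⟩

/-- The map `ψ ↦ ∑ β, ψ_β * K_β`. -/
def kernelMap {K : Expo → Series} (hK : IsKernel K) (ψ : Series) : Series :=
  (kernelFamily hK ψ).hsum

lemma kernelFamily_apply {K : Expo → Series} (hK : IsKernel K) (ψ : Series) (β : Expo) :
    kernelFamily hK ψ β = ψ.coeff β • K β := rfl

/-- The finite index set depends only on `A` and `γ`, so a single one serves a whole family of
series supported in `A`. -/
lemma coeff_kernelMap {K : Expo → Series} (hK : IsKernel K) {A : Set Expo} (hA : A.IsPWO)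
    (γ : Expo) {ψ : Series} (hψ : ψ.support ⊆ A) :
    (kernelMap hK ψ).coeff γ =
      ∑ β ∈ ((hK A hA).2 γ).toFinset, ψ.coeff β * (K β).coeff γ := by
  rw [kernelMap, SummableFamily.coeff_hsum]
  refine finsum_eq_sum_of_support_subset _ fun β hβ => ?_
  rw [Function.mem_support, kernelFamily_apply, coeff_smul] at hβ
  rw [Set.Finite.coe_toFinset]
  exact ⟨hψ (left_ne_zero_of_smul hβ), right_ne_zero_of_smul hβ⟩

lemma support_kernelMap_subset {K : Expo → Series} (hK : IsKernel K) (ψ : Series) :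
    (kernelMap hK ψ).support ⊆ ⋃ β ∈ ψ.support, (K β).support := by
  intro γ hγ
  obtain ⟨β, hβ⟩ := Set.mem_iUnion.1 (SummableFamily.support_hsum_subset hγ)
  rw [mem_support, kernelFamily_apply, coeff_smul] at hβ
  exact Set.mem_iUnion₂.2 ⟨β, left_ne_zero_of_smul hβ, right_ne_zero_of_smul hβ⟩

lemma kernelMap_single {K : Expo → Series} (hK : IsKernel K) (β : Expo) (c : ℝ) :
    kernelMap hK (single β c) = c • K β := by
  ext γ
  rw [kernelMap, SummableFamily.coeff_hsum, finsum_eq_single _ β]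
  · rw [kernelFamily_apply, coeff_single_same]
  · intro δ hδ
    rw [kernelFamily_apply, coeff_single_of_ne hδ, zero_smul_series, coeff_zero]

lemma kernelMap_add {K : Expo → Series} (hK : IsKernel K) (ψ ψ' : Series) :
    kernelMap hK (ψ + ψ') = kernelMap hK ψ + kernelMap hK ψ' := by
  rw [kernelMap, kernelMap, kernelMap, ← SummableFamily.hsum_add]
  congr 1
  ext1 β
  rw [SummableFamily.add_apply, kernelFamily_apply, kernelFamily_apply, kernelFamily_apply,
    coeff_add, add_smul_series]

lemma kernelMap_smul {K : Expo → Series} (hK : IsKernel K) (c : ℝ) (ψ : Series) :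
    kernelMap hK (c • ψ) = c • kernelMap hK ψ := by
  ext γ
  have h := isPWO_support ψ
  rw [coeff_smul, coeff_kernelMap hK h γ (support_smul_subset c ψ),
    coeff_kernelMap hK h γ subset_rfl, smul_eq_mul, Finset.mul_sum]
  exact Finset.sum_congr rfl fun β _ => by rw [coeff_smul, smul_eq_mul, mul_assoc]

/-- Maps that commute with the sums of summable families. -/
structure StrongLinear (L : Series → Series) : Prop where
  exists_family : ∀ {α : Type} (s : SummableFamily Expo ℝ α), ∃ t : SummableFamily Expo ℝ α,
    (∀ a, t a = L (s a)) ∧ t.hsum = L s.hsum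

namespace StrongLinear

variable {L M : Series → Series}

lemma comp (hL : StrongLinear L) (hM : StrongLinear M) : StrongLinear fun ψ => L (M ψ) := by
  refine ⟨fun s => ?_⟩
  obtain ⟨t, ht, hts⟩ := hM.exists_family s
  obtain ⟨u, hu, hus⟩ := hL.exists_family t
  exact ⟨u, fun a => by rw [hu, ht], by rw [hus, hts]⟩

lemma mul_left (F : Series) : StrongLinear fun ψ => F * ψ := ⟨fun s =>
  ⟨F • s, fun a => by rw [SummableFamily.smul_apply, of_symm_smul_of_eq_mul], by
    rw [SummableFamily.hsum_smul]⟩⟩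

/-- The family of the terms of a series. -/
def _root_.Transseries.terms (ψ : Series) : SummableFamily Expo ℝ Expo where
  toFun β := single β (ψ.coeff β)
  isPWO_iUnion_support' := ψ.isPWO_support.mono <| Set.iUnion_subset fun β γ hγ => by
    have := eq_of_mem_support_single hγ
    subst this
    simpa using hγ
  finite_co_support' γ := (Set.finite_singleton γ).subset fun β hβ => by
    by_contra hne
    exact hβ (coeff_single_of_ne (Ne.symm hne))

lemma _root_.Transseries.terms_apply (ψ : Series) (β : Expo) :
    terms ψ β = single β (ψ.coeff β) := rfl

lemma _root_.Transseries.hsum_terms (ψ : Series) : (terms ψ).hsum = ψ := by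
  ext γ
  rw [SummableFamily.coeff_hsum, finsum_eq_single _ γ]
  · rw [terms_apply, coeff_single_same]
  · intro β hβ
    rw [terms_apply, coeff_single_of_ne hβ.symm]

/-- Every series is the sum of its terms, so strongly linear maps need to be compared only on those.
This reduces multiplicativity and associativity of composition to monomials. -/
lemma ext_terms (hL : StrongLinear L) (hM : StrongLinear M) {ψ : Series}
    (h : ∀ β, L (single β (ψ.coeff β)) = M (single β (ψ.coeff β))) : L ψ = M ψ := by
  obtain ⟨t, ht, hts⟩ := hL.exists_family (terms ψ)
  obtain ⟨u, hu, hus⟩ := hM.exists_family (terms ψ)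
  rw [hsum_terms] at hts hus
  rw [← hts, ← hus]
  congr 1
  ext1 β
  rw [ht, hu, terms_apply, h]

lemma map_heval (hL : StrongLinear L) (hsmul : ∀ (c : ℝ) ψ, L (c • ψ) = c • L ψ) {T T' : Series}
    (hT : 0 < T.orderTop) (hT' : 0 < T'.orderTop) (hpow : ∀ n, L (T ^ n) = T' ^ n)
    (p : PowerSeries ℝ) : L (PowerSeries.heval T p) = PowerSeries.heval T' p := by
  obtain ⟨t, ht, hts⟩ := hL.exists_family (SummableFamily.powerSeriesFamily T p)
  rw [PowerSeries.heval_apply, PowerSeries.heval_apply, ← hts]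
  congr 1
  ext1 n
  rw [ht, SummableFamily.powerSeriesFamily_of_orderTop_pos hT,
    SummableFamily.powerSeriesFamily_of_orderTop_pos hT', hsmul, hpow]

end StrongLinear

/-- With `A` the union of all supports in the family, each coefficient is a sum over one finite set
of `β`, and the two summations can be interchanged. -/
lemma strongLinear_kernelMap {K : Expo → Series} (hK : IsKernel K) :
    StrongLinear (kernelMap hK) := by
  refine ⟨fun {α} s => ?_⟩
  set A := ⋃ a, (s a).support with hA
  have hAP : A.IsPWO := s.isPWO_iUnion_support
  have hsub : ∀ a, (s a).support ⊆ A := fun a => Set.subset_iUnion (fun a => (s a).support) a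
  refine ⟨⟨fun a => kernelMap hK (s a), (hK A hAP).1.mono (Set.iUnion_subset fun a =>
    (support_kernelMap_subset hK _).trans (Set.biUnion_subset_biUnion_left (hsub a))),
    fun γ => ?_⟩, fun a => rfl, ?_⟩
  · refine (((hK A hAP).2 γ).biUnion fun β _ => s.finite_co_support β).subset fun a ha => ?_
    rw [Set.mem_ofPred_eq, coeff_kernelMap hK hAP γ (hsub a)] at ha
    obtain ⟨β, hβ, hne⟩ := Finset.exists_ne_zero_of_sum_ne_zero ha
    exact Set.mem_iUnion₂.2 ⟨β, (Set.Finite.mem_toFinset _).1 hβ, left_ne_zero_of_mul hne⟩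
  · ext γ
    rw [SummableFamily.coeff_hsum, coeff_kernelMap hK hAP γ SummableFamily.support_hsum_subset]
    simp only [SummableFamily.coe_mk, coeff_kernelMap hK hAP γ (hsub _)]
    rw [finsum_sum_comm]
    · refine Finset.sum_congr rfl fun β _ => ?_
      rw [SummableFamily.coeff_hsum, finsum_mul]
    · intro β _
      exact (s.finite_co_support β).subset fun a ha => left_ne_zero_of_mul ha

/-! ### Compositions with monomials -/

/-- Positive infinitesimal series. -/
structure IsPosInf (φ : Series) : Prop where
  leadingCoeff_pos : 0 < φ.leadingCoeff
  order_pos : 0 < φ.order.at 0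

lemma order_eq_of_coeff {F : Series} {o : Expo} (h : ∀ γ < o, F.coeff γ = 0)
    (h0 : F.coeff o ≠ 0) : F.order = o := by
  refine le_antisymm (order_le_of_coeff_ne_zero h0) ?_
  by_contra! hlt
  have := coeff_order_eq_zero.1 (h _ hlt)
  exact h0 (by rw [this, coeff_zero])

/-- If `o` has no factors `ℓ₀, …, ℓ_{k-1}`, its logarithm starts with `-o_k ℓ_{k+1}⁻¹`. -/
lemma logMono_eq {o : Expo} {k : ℕ} (h : ∀ i < k, o.at i = 0) :
    ∀ γ ≤ ell (k + 1) (-1), (logMono o).coeff γ =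
      (single (ell (k + 1) (-1)) (-(o.at k)) : Series).coeff γ := by
  intro γ hγ
  -- The inverse of a deeper iterated logarithm is a smaller monomial, so the terms with `i > k` do
  -- not reach the exponents considered here.
  have hlt : ∀ i, k < i → γ < ell (i + 1) (-1) := fun i hi => lt_of_le_of_lt hγ
    (lt_of_at_lt (k := k + 1) (fun j hj => by simp [at_ell, show ¬ k + 1 = j by omega,
      show ¬ i + 1 = j by omega]) (by simp [at_ell, hi.ne']))
  rw [logMono, Finsupp.sum, coeff_sum]
  by_cases hk : k ∈ (ofLex o).support
  · rw [Finset.sum_eq_single_of_mem k hk]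
    · rfl
    · intro i hi hne
      rcases lt_or_gt_of_ne hne with hlt' | hgt
      · exact absurd (h i hlt') (Finsupp.mem_support_iff.1 hi)
      · exact coeff_single_of_ne (hlt i hgt).ne
  · rw [show o.at k = 0 from Finsupp.notMem_support_iff.1 hk, neg_zero, map_zero, coeff_zero]
    refine Finset.sum_eq_zero fun i hi => ?_
    rcases lt_trichotomy i k with hlt' | rfl | hgt
    · exact absurd (h i hlt') (Finsupp.mem_support_iff.1 hi)
    · exact absurd hi hk
    · exact coeff_single_of_ne (hlt i hgt).ne

lemma ell_neg_one_neg (k : ℕ) : ell k (-1) < 0 := by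
  have := ell_pos k one_pos
  rw [← neg_ell]
  exact neg_lt_zero.2 this

/-- The order and the leading coefficient of `-log φ`. -/
lemma order_neg_log {φ : Series} {k : ℕ} (hφ : 0 < φ.leadingCoeff)
    (h : ∀ i < k, φ.order.at i = 0) (hk : 0 < φ.order.at k) :
    (-log φ).order = ell (k + 1) (-1) ∧ (-log φ).leadingCoeff = φ.order.at k := by
  obtain ⟨c, U, hc, hU, hφ'⟩ := exists_eq_single_mul hφ
  have hcoeff : ∀ γ ≤ ell (k + 1) (-1), (-log φ).coeff γ =
      (single (ell (k + 1) (-1)) (φ.order.at k) : Series).coeff γ := by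
    intro γ hγ
    have hγ0 : γ < 0 := lt_of_le_of_lt hγ (ell_neg_one_neg _)
    rw [hφ', log_single_mul hc.ne' hU, coeff_neg, coeff_add, coeff_add, coeff_ulog_of_le hU hγ0.le,
      C_apply, coeff_single_of_ne hγ0.ne, logMono_eq h γ hγ, zero_add, add_zero,
      order_single_mul hc.ne' hU, single_neg, coeff_neg, neg_neg]
  have h0 : (-log φ).coeff (ell (k + 1) (-1)) = φ.order.at k := by
    rw [hcoeff _ le_rfl, coeff_single_same]
  have hord : (-log φ).order = ell (k + 1) (-1) := by
    refine order_eq_of_coeff (fun γ hγ => ?_) (by rw [h0]; exact hk.ne')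
    rw [hcoeff γ hγ.le, coeff_single_of_ne hγ.ne]
  exact ⟨hord, by rw [leadingCoeff_eq, hord, h0]⟩

namespace IsPosInf

variable {φ : Series}

/-- All four facts are carried through one induction: the position and sign of the first nonzero
exponent of `ℓ_i ∘ φ` are what `order_neg_log` needs to find the leading term at the next level. -/
lemma ellComp_aux (hφ : IsPosInf φ) (i : ℕ) : 0 < (ellComp φ i).leadingCoeff ∧
    (∀ k < i, (ellComp φ i).order.at k = 0) ∧ 0 < (ellComp φ i).order.at i ∧
    (0 < i → (ellComp φ i).order = ell i 1) := by
  induction i with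
  | zero => exact ⟨hφ.1, by simp, hφ.2, by simp⟩
  | succ i ih =>
    obtain ⟨h1, h2, h3, -⟩ := ih
    obtain ⟨ho, hc⟩ := order_neg_log h1 h2 h3
    have hpos : 0 < (-log (ellComp φ i)).leadingCoeff := by rw [hc]; exact h3
    have hinv : ellComp φ (i + 1) = rpow (-log (ellComp φ i)) (-1) := by
      rw [rpow_neg_one hpos]; rfl
    have hord : (ellComp φ (i + 1)).order = ell (i + 1) 1 := by
      rw [hinv, order_rpow hpos, ho, smul_ell]; norm_num
    refine ⟨hinv ▸ leadingCoeff_rpow_pos hpos _, fun k hk => ?_, ?_, fun _ => hord⟩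
    · rw [hord, at_ell, if_neg hk.ne']
    · rw [hord]; simp

lemma leadingCoeff_ellComp (hφ : IsPosInf φ) (i : ℕ) : 0 < (ellComp φ i).leadingCoeff :=
  (hφ.ellComp_aux i).1

lemma order_ellComp_succ (hφ : IsPosInf φ) (i : ℕ) : (ellComp φ (i + 1)).order = ell (i + 1) 1 :=
  (hφ.ellComp_aux (i + 1)).2.2.2 i.succ_pos

lemma leadingCoeff_neg_log_ellComp (hφ : IsPosInf φ) (i : ℕ) :
    0 < (-log (ellComp φ i)).leadingCoeff := by
  obtain ⟨h1, h2, h3, -⟩ := hφ.ellComp_aux i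
  rw [(order_neg_log h1 h2 h3).2]
  exact h3

/-- The exponent of the leading monomial of `m ∘ φ` as a function of the exponent of `m`. -/
def _root_.Transseries.leadExpo (φ : Series) : Expo →+ Expo := shear (φ.order - ell 0 1)

lemma strictMono_leadExpo (hφ : IsPosInf φ) : StrictMono (leadExpo φ) :=
  shear_strictMono (by have := hφ.order_pos; simpa using this)

lemma leadExpo_at_zero (β : Expo) : (leadExpo φ β).at 0 = β.at 0 * φ.order.at 0 := by
  simp only [leadExpo, shear_at, at_sub, at_ell_self]; ring

lemma leadExpo_of_at_zero {β : Expo} (h : β.at 0 = 0) : leadExpo φ β = β := by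
  rw [leadExpo, shear_apply, h, zero_smul, add_zero]

lemma monoComp_zero (φ : Series) : monoComp φ 0 = 1 := Finsupp.prod_zero_index

lemma monoComp_ell (hφ : IsPosInf φ) (i : ℕ) (b : ℝ) :
    monoComp φ (ell i b) = rpow (ellComp φ i) b :=
  Finsupp.prod_single_index (rpow_zero' (hφ.leadingCoeff_ellComp i))

lemma monoComp_add (hφ : IsPosInf φ) (β γ : Expo) :
    monoComp φ (β + γ) = monoComp φ β * monoComp φ γ :=
  Finsupp.prod_add_index' (fun i => rpow_zero' (hφ.leadingCoeff_ellComp i))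
    fun i a b => rpow_add (hφ.leadingCoeff_ellComp i) a b

lemma leadingCoeff_monoComp (hφ : IsPosInf φ) (β : Expo) : 0 < (monoComp φ β).leadingCoeff :=
  leadingCoeff_prod_pos fun i _ => leadingCoeff_rpow_pos (hφ.leadingCoeff_ellComp i) _

/-- The principal unit of `m ∘ φ` for the monomial `m` with exponent `β`. -/
def _root_.Transseries.monoUnit (φ : Series) (β : Expo) : Series :=
  (ofLex β).prod fun i b => upow (unitPart (ellComp φ i)) b

lemma isPrincipal_prod {ι : Type*} {s : Finset ι} {F : ι → Series}
    (h : ∀ i ∈ s, IsPrincipal (F i)) : IsPrincipal (∏ i ∈ s, F i) := by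
  classical
  induction s using Finset.induction_on with
  | empty => simpa using isPrincipal_one
  | insert i s hi ih =>
    rw [Finset.forall_mem_insert] at h
    rw [Finset.prod_insert hi]
    exact h.1.mul (ih h.2)

lemma isPrincipal_unitPart_ellComp (hφ : IsPosInf φ) (i : ℕ) :
    IsPrincipal (unitPart (ellComp φ i)) :=
  isPrincipal_unitPart (leadingCoeff_ne_zero.1 (hφ.leadingCoeff_ellComp i).ne')

lemma isPrincipal_monoUnit (hφ : IsPosInf φ) (β : Expo) : IsPrincipal (monoUnit φ β) :=
  isPrincipal_prod fun i _ => (hφ.isPrincipal_unitPart_ellComp i).upow _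

/-- For `i ≥ 1` the leading monomial of `ℓ_i ∘ φ` is `ℓ_i` itself. Only the power of `x` is altered
by the substitution, which is why the map on exponents is a shear. -/
lemma order_monoComp (hφ : IsPosInf φ) (β : Expo) : (monoComp φ β).order = leadExpo φ β := by
  have key : ∀ β : ℕ →₀ ℝ, (monoComp φ (toLex β)).order = leadExpo φ (toLex β) := by
    intro β
    induction β using Finsupp.induction_linear with
    | zero =>
      rw [toLex_zero, monoComp_zero, order_one, map_zero]
    | add β γ hβ hγ =>
      rw [toLex_add, hφ.monoComp_add, order_mul (leadingCoeff_ne_zero.1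
        (hφ.leadingCoeff_monoComp _).ne') (leadingCoeff_ne_zero.1
        (hφ.leadingCoeff_monoComp _).ne'), hβ, hγ, map_add]
    | single i b =>
      change (monoComp φ (ell i b)).order = leadExpo φ (ell i b)
      rw [hφ.monoComp_ell, order_rpow (hφ.leadingCoeff_ellComp i)]
      rcases i with _ | i
      · rw [leadExpo, shear_apply, at_ell_self, smul_sub, smul_ell, mul_one, add_sub_cancel]; rfl
      · rw [hφ.order_ellComp_succ, leadExpo_of_at_zero (by simp [at_ell]), smul_ell, mul_one]
  exact key (ofLex β)

lemma unitPart_mul {F G : Series} : unitPart (F * G) = unitPart F * unitPart G := by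
  by_cases hF : F = 0
  · simp [hF, unitPart]
  by_cases hG : G = 0
  · simp [hG, unitPart]
  rw [unitPart, unitPart, unitPart, mul_single_mul, order_mul hF hG, leadingCoeff_mul, mul_inv,
    neg_add]

lemma unitPart_monoComp (hφ : IsPosInf φ) (β : Expo) : unitPart (monoComp φ β) = monoUnit φ β := by
  have key : ∀ β : ℕ →₀ ℝ, unitPart (monoComp φ (toLex β)) = monoUnit φ (toLex β) := by
    intro β
    induction β using Finsupp.induction_linear with
    | zero =>
      rw [toLex_zero, monoComp_zero]
      simp [unitPart, monoUnit]
    | add β γ hβ hγ =>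
      rw [toLex_add, hφ.monoComp_add, unitPart_mul, hβ, hγ]
      exact (Finsupp.prod_add_index' (fun i => upow_zero _) fun i a b => upow_add _ a b).symm
    | single i b =>
      change unitPart (monoComp φ (ell i b)) = _
      rw [hφ.monoComp_ell]
      obtain ⟨c, U, hc, hU, h⟩ := exists_eq_single_mul (hφ.leadingCoeff_ellComp i)
      rw [h, rpow_single_mul hc.ne' hU, unitPart_single_mul (by positivity) (hU.upow b)]
      refine Eq.trans ?_ (Finsupp.prod_single_index (h := fun i b => upow (unitPart (ellComp φ i)) b)
        (upow_zero _)).symm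
      rw [h, unitPart_single_mul hc.ne' hU]
  exact key (ofLex β)

lemma monoComp_eq (hφ : IsPosInf φ) (β : Expo) : monoComp φ β =
    single (leadExpo φ β) (monoComp φ β).leadingCoeff * monoUnit φ β := by
  rw [← hφ.order_monoComp, ← hφ.unitPart_monoComp,
    single_mul_unitPart (leadingCoeff_ne_zero.1 (hφ.leadingCoeff_monoComp β).ne')]

/-- A monoid that contains the supports of `m ∘ φ`, relative to its leading monomial, for all
monomials `m` in `ℓ₀, …, ℓ_J`. -/
def _root_.Transseries.compCone (φ : Series) (J : ℕ) : AddSubmonoid Expo :=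
  AddSubmonoid.closure (⋃ i ∈ Set.Iic J, (unitPart (ellComp φ i) - 1).support)

lemma pos_of_mem (hφ : IsPosInf φ) (J : ℕ) :
    ∀ γ ∈ ⋃ i ∈ Set.Iic J, (unitPart (ellComp φ i) - 1).support, 0 < γ := by
  intro γ hγ
  obtain ⟨i, _, hi⟩ := Set.mem_iUnion₂.1 hγ
  exact isPrincipal_iff.1 (hφ.isPrincipal_unitPart_ellComp i) γ hi

lemma nonneg_of_mem_compCone (hφ : IsPosInf φ) {J : ℕ} {γ : Expo} (h : γ ∈ compCone φ J) : 0 ≤ γ :=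
  nonneg_of_mem_closure (fun γ hγ => (hφ.pos_of_mem J γ hγ).le) h

lemma isPWO_compCone (hφ : IsPosInf φ) (J : ℕ) : (compCone φ J : Set Expo).IsPWO := by
  refine Set.IsPWO.addSubmonoid_closure (fun γ hγ => (hφ.pos_of_mem J γ hγ).le) ?_
  have : ∀ n : ℕ, (⋃ i ∈ Set.Iio n, (unitPart (ellComp φ i) - 1).support).IsPWO := by
    intro n
    induction n with
    | zero => simp
    | succ n ih =>
      refine (ih.union (isPWO_support (unitPart (ellComp φ n) - 1))).mono ?_
      refine Set.iUnion₂_subset fun i hi => ?_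
      rcases Nat.lt_succ_iff_lt_or_eq.1 hi with h | rfl
      · exact fun γ hγ => Or.inl (Set.mem_iUnion₂.2 ⟨i, h, hγ⟩)
      · exact Set.subset_union_right
  refine (this (J + 1)).mono (Set.biUnion_subset_biUnion_left fun i hi => Nat.lt_succ_of_le hi)

lemma support_prod_subset {ι : Type*} {s : Finset ι} {F : ι → Series} {M : AddSubmonoid Expo}
    (h : ∀ i ∈ s, (F i).support ⊆ M) : (∏ i ∈ s, F i).support ⊆ M := by
  classical
  induction s using Finset.induction_on with
  | empty =>
    rw [Finset.prod_empty, support_one]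
    exact Set.singleton_subset_iff.2 (zero_mem _)
  | insert i s hi ih =>
    rw [Finset.forall_mem_insert] at h
    rw [Finset.prod_insert hi]
    refine support_mul_subset.trans ?_
    rintro _ ⟨a, ha, b, hb, rfl⟩
    exact add_mem (h.1 ha) (ih h.2 hb)

lemma support_monoUnit_subset (φ : Series) {J : ℕ} {β : Expo} (hβ : β ∈ depth J) :
    (monoUnit φ β).support ⊆ compCone φ J := by
  refine support_prod_subset fun i hi => ?_
  refine (support_upow_subset _ _).trans (AddSubmonoid.closure_mono ?_)
  refine Set.subset_biUnion_of_mem (u := fun i => (unitPart (ellComp φ i) - 1).support) ?_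
  rw [Set.mem_Iic]
  by_contra! hlt
  exact (Finsupp.mem_support_iff.1 hi) (hβ i hlt)

lemma support_monoComp_subset (hφ : IsPosInf φ) {J : ℕ} {β : Expo} (hβ : β ∈ depth J) :
    (monoComp φ β).support ⊆ {leadExpo φ β} + (compCone φ J : Set Expo) := by
  rw [hφ.monoComp_eq]
  exact support_mul_subset.trans
    (Set.add_subset_add support_single_subset (support_monoUnit_subset φ hβ))

lemma coeff_monoComp_of_le (hφ : IsPosInf φ) {β γ : Expo} (h : γ ≤ leadExpo φ β) :
    (monoComp φ β).coeff γ =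
      (single (leadExpo φ β) (monoComp φ β).leadingCoeff : Series).coeff γ := by
  rcases h.eq_or_lt with rfl | hlt
  · rw [coeff_single_same, leadingCoeff_eq, hφ.order_monoComp]
  · rw [coeff_single_of_ne hlt.ne, coeff_eq_zero_of_lt_order]
    rwa [hφ.order_monoComp]

open scoped Classical in
/-- `m ∘ φ` for the monomials `m` in `ℓ₀, …, ℓ_J`, and zero for the other ones. -/
def _root_.Transseries.compKernel (φ : Series) (J : ℕ) (β : Expo) : Series :=
  if β ∈ depth J then monoComp φ β else 0

lemma compKernel_of_mem {J : ℕ} {β : Expo} (h : β ∈ depth J) :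
    compKernel φ J β = monoComp φ β := if_pos h

lemma support_compKernel_subset (hφ : IsPosInf φ) (J : ℕ) (β : Expo) :
    (compKernel φ J β).support ⊆ {leadExpo φ β} + (compCone φ J : Set Expo) := by
  rw [compKernel]
  split_ifs with h
  · exact hφ.support_monoComp_subset h
  · simp

/-- Both `τ '' A` and `S` are partially well-ordered; so is their sum, and each exponent splits in
finitely many ways. Injectivity of `τ` recovers `β` from the first summand. -/
lemma isKernel_of_support_subset {K : Expo → Series} {τ : Expo → Expo} (hτ : StrictMono τ)
    {S : Set Expo} (hS : S.IsPWO) (h : ∀ β, (K β).support ⊆ {τ β} + S) : IsKernel K := by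
  intro A hA
  have hA' : (τ '' A).IsPWO := hA.image_of_monotone hτ.monotone
  refine ⟨(hA'.add hS).mono ?_, fun γ => ?_⟩
  · refine Set.iUnion₂_subset fun β hβ => (h β).trans (Set.add_subset_add ?_ subset_rfl)
    exact Set.singleton_subset_iff.2 (Set.mem_image_of_mem τ hβ)
  · refine (Set.Finite.preimage (f := τ) hτ.injective.injOn
      ((Set.AddAntidiagonal.finite_of_isPWO hA' hS γ).image Prod.fst)).subset ?_
    rintro β ⟨hβ, hne⟩
    obtain ⟨a, rfl, s, hs, hsum⟩ := h β hne
    exact ⟨(τ β, s), ⟨Set.mem_image_of_mem τ hβ, hs, hsum⟩, rfl⟩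

lemma isKernel (hφ : IsPosInf φ) (J : ℕ) : IsKernel (compKernel φ J) :=
  isKernel_of_support_subset hφ.strictMono_leadExpo (hφ.isPWO_compCone J)
    (hφ.support_compKernel_subset J)

/-- The composition `ψ ∘ φ` for series `ψ` in `ℓ₀, …, ℓ_J`. -/
def comp (hφ : IsPosInf φ) (J : ℕ) (ψ : Series) : Series := kernelMap (hφ.isKernel J) ψ

/-- Cutting the kernel off at `depth J` loses nothing, since the discarded monomials do not occur in
`ψ`. The cut-off leaves only finitely many `ℓ_i ∘ φ` to contribute to the common monoid `compCone φ
J`. -/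
lemma isComp_comp (hφ : IsPosInf φ) {J : ℕ} {ψ : Series} (hψ : ψ.support ⊆ depth J) :
    IsComp ψ φ (hφ.comp J ψ) := by
  refine ⟨hφ.1, hφ.2, kernelFamily (hφ.isKernel J) ψ, fun β => ?_, rfl⟩
  rw [kernelFamily_apply]
  by_cases h : ψ.coeff β = 0
  · rw [h, zero_smul_series, zero_smul_series]
  · rw [compKernel_of_mem (hψ h)]

end IsPosInf

/-! ### Uniqueness and linearity of formal composition -/

lemma IsComp.isPosInf {ψ φ χ : Series} (h : IsComp ψ φ χ) : IsPosInf φ := ⟨h.1, h.2.1⟩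

lemma IsComp.unique {ψ φ χ χ' : Series} (h : IsComp ψ φ χ) (h' : IsComp ψ φ χ') : χ = χ' := by
  obtain ⟨-, -, s, hs, rfl⟩ := h
  obtain ⟨-, -, t, ht, rfl⟩ := h'
  congr 1
  ext1 β
  rw [hs, ht]

lemma IsComp.eq_comp {ψ φ χ : Series} (h : IsComp ψ φ χ) (hφ : IsPosInf φ) {J : ℕ}
    (hψ : ψ.support ⊆ depth J) : χ = hφ.comp J ψ := h.unique (hφ.isComp_comp hψ)

lemma IsComp.sub {ψ ψ' φ χ χ' : Series} (h : IsComp ψ φ χ) (h' : IsComp ψ' φ χ') :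
    IsComp (ψ - ψ') φ (χ - χ') := by
  obtain ⟨h1, h2, s, hs, rfl⟩ := h
  obtain ⟨-, -, t, ht, rfl⟩ := h'
  refine ⟨h1, h2, s - t, fun β => ?_, SummableFamily.hsum_sub⟩
  rw [SummableFamily.sub_apply, hs, ht, coeff_sub, sub_smul_series]

lemma isComp_C {φ : Series} (hφ : IsPosInf φ) (c : ℝ) : IsComp (C c) φ (C c) := by
  have := hφ.isComp_comp (J := 0) (ψ := C c) (support_single_subset.trans
    (Set.singleton_subset_iff.2 (zero_mem _)))
  rwa [IsPosInf.comp, C_apply, kernelMap_single, IsPosInf.compKernel_of_mem (zero_mem _),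
    IsPosInf.monoComp_zero, ← C_mul_eq_smul, mul_one] at this

lemma support_mul_subset_submodule {M : Submodule ℝ Expo} {F G : Series} (hF : F.support ⊆ M)
    (hG : G.support ⊆ M) : (F * G).support ⊆ M := by
  refine support_mul_subset.trans ?_
  rintro _ ⟨a, ha, b, hb, rfl⟩
  exact M.add_mem (hF ha) (hG hb)

lemma support_one_subset (M : Submodule ℝ Expo) : (1 : Series).support ⊆ M := by
  rw [support_one]
  exact Set.singleton_subset_iff.2 M.zero_mem

lemma support_pow_subset {M : Submodule ℝ Expo} {F : Series} (hF : F.support ⊆ M) (n : ℕ) :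
    (F ^ n).support ⊆ M := by
  induction n with
  | zero => rw [pow_zero]; exact support_one_subset M
  | succ n ih => rw [pow_succ]; exact support_mul_subset_submodule ih hF

lemma support_subset_depth {J : ℕ} {F : Series} (hF : F ∈ LInf J) : F.support ⊆ depth J := hF.1

namespace IsPosInf

variable {φ : Series} (hφ : IsPosInf φ) {J : ℕ}
include hφ

/-! ### Composition is a homomorphism -/

lemma strongLinear_comp : StrongLinear (hφ.comp J) := strongLinear_kernelMap _

lemma comp_add (ψ ψ' : Series) : hφ.comp J (ψ + ψ') = hφ.comp J ψ + hφ.comp J ψ' :=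
  kernelMap_add _ _ _

lemma comp_smul (c : ℝ) (ψ : Series) : hφ.comp J (c • ψ) = c • hφ.comp J ψ := kernelMap_smul _ _ _

lemma comp_single {β : Expo} (h : β ∈ depth J) (c : ℝ) :
    hφ.comp J (single β c) = C c * monoComp φ β := by
  rw [comp, kernelMap_single, compKernel_of_mem h, C_mul_eq_smul]

lemma comp_C (c : ℝ) : hφ.comp J (C c) = C c := by
  rw [C_apply, hφ.comp_single (zero_mem _), monoComp_zero, mul_one, C_apply]

lemma comp_one : hφ.comp J 1 = 1 := by
  rw [← C_one, hφ.comp_C]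

lemma comp_zero : hφ.comp J 0 = 0 := by
  rw [← C_zero, hφ.comp_C]

lemma comp_neg (ψ : Series) : hφ.comp J (-ψ) = -hφ.comp J ψ := by
  have := hφ.comp_add (J := J) (-ψ) ψ
  rw [neg_add_cancel, hφ.comp_zero] at this
  exact eq_neg_of_add_eq_zero_left this.symm

lemma comp_sub (ψ ψ' : Series) : hφ.comp J (ψ - ψ') = hφ.comp J ψ - hφ.comp J ψ' := by
  rw [sub_eq_add_neg, hφ.comp_add, hφ.comp_neg, sub_eq_add_neg]

lemma comp_sum {ι : Type*} (s : Finset ι) (F : ι → Series) :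
    hφ.comp J (∑ i ∈ s, F i) = ∑ i ∈ s, hφ.comp J (F i) := by
  classical
  induction s using Finset.induction_on with
  | empty => simpa using hφ.comp_zero
  | insert i s hi ih => rw [Finset.sum_insert hi, Finset.sum_insert hi, hφ.comp_add, ih]

/-- Both sides are strongly linear in each factor, so two applications of `ext_terms` leave pairs of
monomials, where the claim is `monoComp_add`. -/
lemma comp_mul {ψ ψ' : Series} (hψ : ψ.support ⊆ depth J) (hψ' : ψ'.support ⊆ depth J) :
    hφ.comp J (ψ * ψ') = hφ.comp J ψ * hφ.comp J ψ' := by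
  have hterm : ∀ β ∈ depth J, ∀ c, hφ.comp J (single β c * ψ') =
      hφ.comp J (single β c) * hφ.comp J ψ' := by
    intro β hβ c
    refine StrongLinear.ext_terms (hφ.strongLinear_comp.comp (StrongLinear.mul_left (single β c)))
      ((StrongLinear.mul_left (hφ.comp J (single β c))).comp hφ.strongLinear_comp) fun γ => ?_
    by_cases h : ψ'.coeff γ = 0
    · simp only [h, map_zero, mul_zero, hφ.comp_zero]
    · have hγ := hψ' h
      simp only [single_mul_single]
      rw [hφ.comp_single (add_mem hβ hγ), hφ.comp_single hβ, hφ.comp_single hγ, hφ.monoComp_add,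
        map_mul]
      ring
  rw [mul_comm ψ, mul_comm (hφ.comp J ψ)]
  refine StrongLinear.ext_terms (hφ.strongLinear_comp.comp (StrongLinear.mul_left ψ'))
    ((StrongLinear.mul_left (hφ.comp J ψ')).comp hφ.strongLinear_comp) fun β => ?_
  by_cases h : ψ.coeff β = 0
  · simp only [h, map_zero, mul_zero, hφ.comp_zero]
  · rw [mul_comm ψ', hterm β (hψ h), mul_comm]

lemma comp_pow {ψ : Series} (hψ : ψ.support ⊆ depth J) (n : ℕ) :
    hφ.comp J (ψ ^ n) = hφ.comp J ψ ^ n := by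
  induction n with
  | zero => rw [pow_zero, pow_zero, hφ.comp_one]
  | succ n ih => rw [pow_succ, pow_succ, hφ.comp_mul (support_pow_subset hψ n) hψ, ih]

lemma support_comp_subset (ψ : Series) :
    (hφ.comp J ψ).support ⊆ leadExpo φ '' ψ.support + (compCone φ J : Set Expo) := by
  refine (support_kernelMap_subset _ _).trans (Set.iUnion₂_subset fun β hβ => ?_)
  refine (hφ.support_compKernel_subset J β).trans (Set.add_subset_add ?_ subset_rfl)
  exact Set.singleton_subset_iff.2 (Set.mem_image_of_mem _ hβ)

lemma isPrincipal_comp {U : Series} (hU : IsPrincipal U) : IsPrincipal (hφ.comp J U) := by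
  rw [isPrincipal_iff] at hU ⊢
  intro γ hγ
  rw [← hφ.comp_one (J := J), ← hφ.comp_sub] at hγ
  obtain ⟨_, ⟨β, hβ, rfl⟩, s, hs, rfl⟩ := hφ.support_comp_subset _ hγ
  have := hφ.strictMono_leadExpo (hU β hβ)
  rw [map_zero] at this
  exact add_pos_of_pos_of_nonneg this (hφ.nonneg_of_mem_compCone hs)

lemma comp_heval {U : Series} (hU : IsPrincipal U) (hUJ : U.support ⊆ depth J)
    (p : PowerSeries ℝ) : hφ.comp J (PowerSeries.heval (U - 1) p) =
      PowerSeries.heval (hφ.comp J U - 1) p := by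
  refine hφ.strongLinear_comp.map_heval hφ.comp_smul hU (hφ.isPrincipal_comp hU) (fun n => ?_) p
  rw [hφ.comp_pow ((support_sub_subset _ _).trans (Set.union_subset hUJ (support_one_subset _))),
    hφ.comp_sub, hφ.comp_one]

lemma comp_single_mul {o : Expo} (ho : o ∈ depth J) (c : ℝ) {U : Series}
    (hUJ : U.support ⊆ depth J) :
    hφ.comp J (single o c * U) = single (leadExpo φ o) (c * (monoComp φ o).leadingCoeff) *
      (monoUnit φ o * hφ.comp J U) := by
  rw [hφ.comp_mul (support_single_subset.trans (Set.singleton_subset_iff.2 ho)) hUJ,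
    hφ.comp_single ho]
  nth_rw 1 [hφ.monoComp_eq o]
  rw [C_apply, ← mul_assoc, ← mul_assoc, single_mul_single, zero_add]

lemma order_comp {ψ : Series} (hψ : ψ ∈ LInf J) (h0 : ψ ≠ 0) :
    (hφ.comp J ψ).order = leadExpo φ ψ.order ∧ (hφ.comp J ψ).leadingCoeff =
      ψ.leadingCoeff * (monoComp φ ψ.order).leadingCoeff := by
  have hU := isPrincipal_unitPart h0
  have hc := leadingCoeff_ne_zero.2 h0
  have h1 := (hφ.isPrincipal_monoUnit ψ.order).mul (hφ.isPrincipal_comp (J := J) hU)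
  have h2 : hφ.comp J ψ = single (leadExpo φ ψ.order)
      (ψ.leadingCoeff * (monoComp φ ψ.order).leadingCoeff) *
      (monoUnit φ ψ.order * hφ.comp J (unitPart ψ)) := by
    conv_lhs => rw [← single_mul_unitPart h0]
    exact hφ.comp_single_mul (LInf.order_mem hψ) _ (support_subset_depth (LInf.unitPart_mem hψ))
  rw [h2, order_single_mul (mul_ne_zero hc (hφ.leadingCoeff_monoComp _).ne') h1,
    leadingCoeff_single_mul h1]
  exact ⟨rfl, rfl⟩

/-- Leading terms go to nonzero leading terms, so composition with `φ` is injective; uniqueness of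
the formal inverse rests on this. -/
lemma comp_ne_zero {ψ : Series} (hψ : ψ ∈ LInf J) (h0 : ψ ≠ 0) : hφ.comp J ψ ≠ 0 := by
  rw [← leadingCoeff_ne_zero, (hφ.order_comp hψ h0).2]
  exact mul_ne_zero (leadingCoeff_ne_zero.2 h0) (hφ.leadingCoeff_monoComp _).ne'

lemma leadingCoeff_comp_pos {ψ : Series} (hψ : ψ ∈ LInf J) (h : 0 < ψ.leadingCoeff) :
    0 < (hφ.comp J ψ).leadingCoeff := by
  rw [(hφ.order_comp hψ (leadingCoeff_ne_zero.1 h.ne')).2]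
  exact mul_pos h (hφ.leadingCoeff_monoComp _)

lemma comp_comp_isPosInf {ψ : Series} (hψ : ψ ∈ LInf J) (h : IsPosInf ψ) :
    IsPosInf (hφ.comp J ψ) := by
  refine ⟨hφ.leadingCoeff_comp_pos hψ h.1, ?_⟩
  rw [(hφ.order_comp hψ (leadingCoeff_ne_zero.1 h.1.ne')).1, leadExpo_at_zero]
  exact mul_pos h.2 hφ.2

lemma monoComp_smul (b : ℝ) (o : Expo) : monoComp φ (b • o) = rpow (monoComp φ o) b := by
  rw [monoComp, monoComp, Finsupp.prod, Finsupp.prod,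
    rpow_prod fun i _ => leadingCoeff_rpow_pos (hφ.leadingCoeff_ellComp i) _]
  refine (Finset.prod_subset (Finsupp.support_smul (b := b) (g := ofLex o))
    fun i _ hi => ?_).trans (Finset.prod_congr rfl fun i _ => ?_)
  · rw [Finsupp.notMem_support_iff] at hi
    change rpow (ellComp φ i) ((b • ofLex o) i) = 1
    rw [hi, rpow_zero' (hφ.leadingCoeff_ellComp i)]
  · rw [rpow_rpow (hφ.leadingCoeff_ellComp i), mul_comm]; rfl

lemma comp_rpow {ψ : Series} (hψ : ψ ∈ LInf J) (h : 0 < ψ.leadingCoeff) (b : ℝ) :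
    hφ.comp J (rpow ψ b) = rpow (hφ.comp J ψ) b := by
  have h0 := leadingCoeff_ne_zero.1 h.ne'
  have hU := isPrincipal_unitPart h0
  have hUJ := (support_subset_depth (LInf.unitPart_mem hψ))
  have ho := LInf.order_mem hψ
  have hsingle : ∀ {γ : Expo}, γ ∈ depth J → ∀ c : ℝ, (single γ c : Series).support ⊆ depth J :=
    fun hγ c => support_single_subset.trans (Set.singleton_subset_iff.2 hγ)
  have hUb := support_subset_depth (LInf.upow_mem hU (LInf.unitPart_mem hψ) b)
  conv_rhs => rw [← single_mul_unitPart h0, hφ.comp_mul (hsingle ho _) hUJ, hφ.comp_single ho,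
    C_apply]
  conv_lhs => rw [← single_mul_unitPart h0, rpow_single_mul h.ne' hU,
    hφ.comp_mul (hsingle (Submodule.smul_mem _ b ho) _) hUb,
    hφ.comp_single (Submodule.smul_mem _ b ho), hφ.monoComp_smul, upow, hφ.comp_heval hU hUJ]
  have hC : 0 < (single 0 ψ.leadingCoeff : Series).leadingCoeff := by rwa [leadingCoeff_of_single]
  have hpU := hφ.isPrincipal_comp (J := J) hU
  have hpU' : 0 < (hφ.comp J (unitPart ψ)).leadingCoeff := by
    have := leadingCoeff_single_mul (o := 0) (c := 1) hpU
    rw [single_zero_one, one_mul] at this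
    rw [this]; exact one_pos
  have hru : rpow (hφ.comp J (unitPart ψ)) b = upow (hφ.comp J (unitPart ψ)) b := by
    have := rpow_single_mul (o := 0) one_ne_zero hpU b
    rwa [single_zero_one, one_mul, smul_zero, Real.one_rpow, single_zero_one, one_mul] at this
  rw [rpow_mul (by rw [leadingCoeff_mul]; exact mul_pos hC (hφ.leadingCoeff_monoComp _)) hpU',
    rpow_mul hC (hφ.leadingCoeff_monoComp _), rpow_single h, smul_zero, hru, C_apply]
  rfl

lemma neg_log_ellComp (i : ℕ) : rpow (ellComp φ (i + 1)) (-1) = -log (ellComp φ i) := by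
  rw [rpow_neg_one (hφ.leadingCoeff_ellComp _)]
  exact inv_inv _

lemma comp_logMono {o : Expo} (ho : ∀ i, J ≤ i → o.at i = 0) :
    hφ.comp J (logMono o) = log (monoComp φ o) := by
  rw [logMono, Finsupp.sum, hφ.comp_sum, monoComp, Finsupp.prod,
    log_prod fun i _ => leadingCoeff_rpow_pos (hφ.leadingCoeff_ellComp i) _]
  refine Finset.sum_congr rfl fun i hi => ?_
  have hiJ : i < J := by
    by_contra! hle
    exact (Finsupp.mem_support_iff.1 hi) (ho i hle)
  rw [ellPow, hφ.comp_single (ell_mem_depth hiJ _), hφ.monoComp_ell, hφ.neg_log_ellComp,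
    log_rpow (hφ.leadingCoeff_ellComp i), map_neg, ← C_mul_eq_smul]
  change -C (ofLex o i) * -log (ellComp φ i) = C (ofLex o i) * log (ellComp φ i)
  ring

lemma comp_log {ψ : Series} (hψ : ψ ∈ LInf J) (h : 0 < ψ.leadingCoeff)
    (ho : ∀ i, J ≤ i → ψ.order.at i = 0) : hφ.comp J (log ψ) = log (hφ.comp J ψ) := by
  have h0 := leadingCoeff_ne_zero.1 h.ne'
  have hU := isPrincipal_unitPart h0
  have hUJ := (support_subset_depth (LInf.unitPart_mem hψ))
  have hoJ := LInf.order_mem hψ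
  have hC : 0 < (single 0 ψ.leadingCoeff : Series).leadingCoeff := by rwa [leadingCoeff_of_single]
  have hpU := hφ.isPrincipal_comp (J := J) hU
  have hpU' : 0 < (hφ.comp J (unitPart ψ)).leadingCoeff := by
    have := leadingCoeff_single_mul (o := 0) (c := 1) hpU
    rw [single_zero_one, one_mul] at this
    rw [this]; exact one_pos
  have hru : log (hφ.comp J (unitPart ψ)) = ulog (hφ.comp J (unitPart ψ)) := by
    have := log_single_mul (o := 0) one_ne_zero hpU
    rwa [single_zero_one, one_mul, Real.log_one, map_zero, logMono_zero, zero_add, zero_add] at this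
  conv_lhs => rw [← single_mul_unitPart h0, log_single_mul h.ne' hU, hφ.comp_add, hφ.comp_add,
    hφ.comp_C, hφ.comp_logMono ho, ulog, hφ.comp_heval hU hUJ]
  conv_rhs => rw [← single_mul_unitPart h0, hφ.comp_mul
    (support_single_subset.trans (Set.singleton_subset_iff.2 hoJ)) hUJ, hφ.comp_single hoJ,
    C_apply, log_mul (by rw [leadingCoeff_mul]; exact mul_pos hC (hφ.leadingCoeff_monoComp _)) hpU',
    log_mul hC (hφ.leadingCoeff_monoComp _), log_single h, logMono_zero, add_zero, hru]
  rfl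

end IsPosInf

/-! ### Substitutions that preserve `L_J^∞` -/

/-- Substitutions under which `L_J^∞` is stable. -/
structure Admissible (J : ℕ) (φ : Series) : Prop extends IsPosInf φ where
  mem : φ ∈ LInf J
  pos : 1 ≤ J
  order_at : ∀ i, J ≤ i → φ.order.at i = 0

namespace Admissible

variable {φ : Series} {J : ℕ} (hφ : Admissible J φ)
include hφ

lemma order_ellComp_at {i k : ℕ} (hi : i < J) (hk : J ≤ k) : (ellComp φ i).order.at k = 0 := by
  rcases i with _ | i
  · exact hφ.order_at k hk
  · rw [hφ.order_ellComp_succ, at_ell, if_neg (by omega)]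

/-- Each level takes one logarithm, which costs one unit of depth beyond the leading monomial. That
monomial involves no `ℓ_k` with `k ≥ J`: for `φ` by `order_at`, and for `ℓ_i ∘ φ` with `0 < i < J`
because it is `ℓ_i`. -/
lemma ellComp_mem {i : ℕ} (hi : i ≤ J) : ellComp φ i ∈ LInf J := by
  induction i with
  | zero => exact hφ.mem
  | succ i ih =>
    exact LInf.inv_mem (LInf.neg_mem (LInf.log_mem (ih (by omega)) (hφ.leadingCoeff_ellComp i)
      fun k hk => hφ.order_ellComp_at hi hk)) (hφ.leadingCoeff_neg_log_ellComp i)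

lemma tame_compCone : Tame J (compCone φ J : Set Expo) := by
  refine Tame.closure (Tame.biUnion (Set.finite_Iic J) fun i hi => ?_)
    fun γ hγ => (hφ.pos_of_mem J γ hγ).le
  exact LInf.sub_mem (LInf.unitPart_mem (hφ.ellComp_mem hi)) LInf.one_mem

lemma order_sub_mem : φ.order - ell 0 1 ∈ depth J :=
  sub_mem (LInf.order_mem hφ.mem) (ell_mem_depth (Nat.zero_le _) _)

lemma tame_image {S : Set Expo} (hS : Tame J S) : Tame J (leadExpo φ '' S) :=
  hS.image_shear hφ.order_sub_mem (by have := hφ.order_pos; simpa using this)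

lemma comp_mem {ψ : Series} (hψ : ψ ∈ LInf J) : hφ.comp J ψ ∈ LInf J :=
  LInf.of_subset ((hφ.tame_image hψ).add hφ.tame_compCone) (hφ.support_comp_subset ψ)

lemma ellComp_comp {ψ : Series} (hψ : Admissible J ψ) {i : ℕ} (hi : i ≤ J) :
    ellComp (hφ.comp J ψ) i = hφ.comp J (ellComp ψ i) := by
  induction i with
  | zero => rfl
  | succ i ih =>
    have hmem := hψ.ellComp_mem (i := i) (by omega)
    have hlc := hψ.leadingCoeff_ellComp i
    have hord : ∀ k, J ≤ k → (ellComp ψ i).order.at k = 0 := fun k => hψ.order_ellComp_at hi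
    change (-log (ellComp (hφ.comp J ψ) i))⁻¹ = hφ.comp J (-log (ellComp ψ i))⁻¹
    have hpos := hψ.leadingCoeff_neg_log_ellComp i
    have hmem' := LInf.neg_mem (LInf.log_mem hmem hlc hord)
    rw [ih (by omega), ← hφ.comp_log hmem hlc hord, ← hφ.comp_neg, ← rpow_neg_one hpos,
      hφ.comp_rpow hmem' hpos, rpow_neg_one (hφ.leadingCoeff_comp_pos hmem' hpos)]

lemma monoComp_comp {ψ : Series} (hψ : Admissible J ψ) {β : Expo} (hβ : β ∈ depth J) :
    monoComp (hφ.comp J ψ) β = hφ.comp J (monoComp ψ β) := by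
  classical
  have hle : ∀ i ∈ (ofLex β).support, i ≤ J := by
    intro i hi
    by_contra! hlt
    exact (Finsupp.mem_support_iff.1 hi) (hβ i hlt)
  rw [monoComp, monoComp, Finsupp.prod, Finsupp.prod]
  generalize (ofLex β).support = s at hle
  induction s using Finset.induction_on with
  | empty => simpa using hφ.comp_one.symm
  | insert i s hi ih =>
    rw [Finset.forall_mem_insert] at hle
    have h1 : ∀ j ≤ J, rpow (ellComp ψ j) (ofLex β j) ∈ LInf J := fun j hj =>
      LInf.rpow_mem (hψ.ellComp_mem hj) (hψ.leadingCoeff_ellComp j) _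
    rw [Finset.prod_insert hi, Finset.prod_insert hi, ih hle.2, hφ.ellComp_comp hψ hle.1,
      hφ.comp_mul (support_subset_depth (h1 i hle.1))
        (support_subset_depth (LInf.prod_mem fun j hj => h1 j (hle.2 j hj))),
      hφ.comp_rpow (hψ.ellComp_mem hle.1) (hψ.leadingCoeff_ellComp i)]

/-- Associativity of composition. -/
lemma comp_comp {ψ : Series} (hψ : Admissible J ψ) {χ : Series} (hχ : χ ∈ LInf J)
    (hφψ : IsPosInf (hφ.comp J ψ)) : hφ.comp J (hψ.comp J χ) = hφψ.comp J χ := by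
  refine StrongLinear.ext_terms (hφ.strongLinear_comp.comp hψ.strongLinear_comp)
    hφψ.strongLinear_comp fun β => ?_
  by_cases h : χ.coeff β = 0
  · simp only [h, map_zero, IsPosInf.comp_zero]
  · have hβ : β ∈ depth J := support_subset_depth hχ h
    rw [hψ.comp_single hβ, hφψ.comp_single hβ, C_mul_eq_smul, hφ.comp_smul,
      hφ.monoComp_comp hψ hβ, C_mul_eq_smul]

end Admissible

/-! ### The identity series as a unit for composition -/

lemma X_eq_single : X = single (ell 0 1) 1 := rfl

lemma X_mem (J : ℕ) : X ∈ LInf J := LInf.single_mem (ell_mem_depth (Nat.zero_le _) _) _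

lemma isPosInf_X : IsPosInf X := by
  refine ⟨?_, ?_⟩
  · rw [X_eq_single, leadingCoeff_of_single]; exact one_pos
  · rw [X_eq_single, order_single one_ne_zero]; simp

lemma IsPosInf.comp_X {φ : Series} (hφ : IsPosInf φ) (J : ℕ) : hφ.comp J X = φ := by
  rw [X_eq_single, hφ.comp_single (ell_mem_depth (Nat.zero_le _) _), C_one, one_mul,
    hφ.monoComp_ell]
  exact rpow_one' hφ.1

lemma ellComp_X (i : ℕ) : ellComp X i = single (ell i 1) 1 := by
  induction i with
  | zero => rfl
  | succ i ih =>
    change (-log (ellComp X i))⁻¹ = _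
    rw [ih, log_single one_pos, Real.log_one, map_zero, zero_add, logMono_ell, ellPow, single_neg,
      neg_neg, inv_single, inv_one, neg_ell, neg_neg]

lemma monoComp_X (β : Expo) : monoComp X β = single β 1 := by
  have key : ∀ β : ℕ →₀ ℝ, monoComp X (toLex β) = single (toLex β) 1 := by
    intro β
    induction β using Finsupp.induction_linear with
    | zero => rw [toLex_zero, IsPosInf.monoComp_zero, single_zero_one]
    | add β γ hβ hγ => rw [toLex_add, isPosInf_X.monoComp_add, hβ, hγ, single_mul_single, one_mul]
    | single i b =>
      change monoComp X (ell i b) = single (ell i b) 1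
      rw [isPosInf_X.monoComp_ell, ellComp_X, rpow_single one_pos, Real.one_rpow, smul_ell, mul_one]
  exact key (ofLex β)

lemma comp_X_right {J : ℕ} {ψ : Series} (hψ : ψ.support ⊆ depth J) : isPosInf_X.comp J ψ = ψ := by
  have hid : StrongLinear fun ψ => ψ := ⟨fun s => ⟨s, fun _ => rfl, rfl⟩⟩
  refine StrongLinear.ext_terms isPosInf_X.strongLinear_comp hid fun β => ?_
  by_cases h : ψ.coeff β = 0
  · simp only [h, map_zero, isPosInf_X.comp_zero]
  · rw [isPosInf_X.comp_single (hψ h), monoComp_X, C_apply, single_mul_single, zero_add, mul_one]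

/-! ### Triangular linear equations -/

/-- A linear equation `∑ β, ψ_β * K_β = b` whose leading exponents `τ β` are strictly increasing
can be solved recursively. -/
lemma exists_kernelMap_eq {K : Expo → Series} (hK : IsKernel K) {τ : Expo → Expo} {P : Set Expo}
    (hP : P.IsPWO) (hτ : StrictMonoOn τ P) (hlead : ∀ β ∈ P, (K β).coeff (τ β) ≠ 0)
    (hge : ∀ β ∈ P, ∀ γ ∈ (K β).support, τ β ≤ γ)
    (hmem : ∀ β ∈ P, (K β).support ⊆ τ '' P) {b : Series} (hb : b.support ⊆ τ '' P) :
    ∃ ψ : Series, ψ.support ⊆ P ∧ kernelMap hK ψ = b := by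
  classical
  have hwf : WellFounded fun β γ : P => β < γ := hP.isWF
  let s : Expo → Finset Expo := fun γ => ((hK P hP).2 γ).toFinset
  let F : (β : P) → ((γ : P) → γ < β → ℝ) → ℝ := fun β u =>
    -- The equation at the exponent `τ β` is solved for `ψ_β`. Since `K γ` starts at `τ γ`, the only
    -- other unknowns in it are the `ψ_γ` with `γ < β`.
    (b.coeff (τ β) - ∑ γ ∈ s (τ β), if h : ∃ hγ : γ ∈ P, (⟨γ, hγ⟩ : P) < β then
      u ⟨γ, h.1⟩ h.2 * (K γ).coeff (τ β) else 0) / (K β).coeff (τ β)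
  let u : P → ℝ := hwf.fix F
  let ψ : Series := ⟨fun β => if h : β ∈ P then u ⟨β, h⟩ else 0, hP.mono fun β hβ => by
    by_contra h
    simp [h] at hβ⟩
  have hψP : ψ.support ⊆ P := fun β hβ => by
    by_contra h
    exact hβ (dif_neg h)
  have hψu : ∀ β (h : β ∈ P), ψ.coeff β = u ⟨β, h⟩ := fun β h => dif_pos h
  refine ⟨ψ, hψP, ?_⟩
  ext γ
  rw [coeff_kernelMap hK hP γ hψP]
  by_cases hγ : γ ∈ τ '' P
  · obtain ⟨β, hβ, rfl⟩ := hγ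
    have hu : u ⟨β, hβ⟩ = F ⟨β, hβ⟩ fun γ _ => u γ := hwf.fix_eq F ⟨β, hβ⟩
    have hβs : β ∈ s (τ β) := (Set.Finite.mem_toFinset _).2 ⟨hβ, hlead β hβ⟩
    change ∑ γ ∈ s (τ β), ψ.coeff γ * (K γ).coeff (τ β) = _
    have hterm : ∀ γ ∈ s (τ β), ψ.coeff γ * (K γ).coeff (τ β) =
        (if γ = β then ψ.coeff β * (K β).coeff (τ β) else 0) +
        if h : ∃ hγ : γ ∈ P, (⟨γ, hγ⟩ : P) < ⟨β, hβ⟩ then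
          u ⟨γ, h.1⟩ * (K γ).coeff (τ β) else 0 := by
      intro γ hγs
      obtain ⟨hγ, hne⟩ := (Set.Finite.mem_toFinset _).1 hγs
      have hle : γ ≤ β := by
        by_contra! hlt
        exact absurd (hge γ hγ _ hne) (not_le.2 (hτ hβ hγ hlt))
      rcases hle.eq_or_lt with rfl | hlt
      · rw [if_pos rfl, dif_neg, add_zero]
        rintro ⟨_, h⟩
        exact lt_irrefl _ h
      · rw [if_neg hlt.ne, dif_pos ⟨hγ, hlt⟩, zero_add, hψu γ hγ]
    rw [Finset.sum_congr rfl hterm, Finset.sum_add_distrib, Finset.sum_ite_eq' (s (τ β)) β,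
      if_pos hβs, hψu β hβ, hu]
    simp only [F]
    rw [div_mul_cancel₀ _ (hlead β hβ), sub_add_cancel]
  -- Away from `τ '' P` there is no unknown to adjust, but both sides vanish there by `hb` and
  -- `hmem`.
  · have h0 : b.coeff γ = 0 := by
      by_contra h
      exact hγ (hb h)
    rw [h0]
    refine Finset.sum_eq_zero fun β hβ => ?_
    obtain ⟨hβP, hne⟩ := (Set.Finite.mem_toFinset _).1 hβ
    exact absurd (hmem β hβP hne) hγ

/-! ### Compositional inverses -/

/-- The inverse of `shear o`. -/
lemma shear_shear_inv {o : Expo} (h : 1 + o.at 0 ≠ 0) (γ : Expo) :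
    shear o (shear (-(1 + o.at 0)⁻¹ • o) γ) = γ := by
  ext i
  simp only [shear_at, at_smul]
  field_simp
  ring

namespace Admissible

variable {φ : Series} {J : ℕ} (hφ : Admissible J φ)
include hφ

/-- The equation `h ∘ φ = x` is triangular with leading exponents `leadExpo φ β`. The set `T` of
exponents that can occur in it contains that of `x` and is stable under adding `compCone φ J`; the
candidate support `P` is the preimage of `T` under the invertible shear, hence tame. -/
lemma exists_left_inverse : ∃ h, Admissible J h ∧ hφ.comp J h = X := by
  set o := φ.order - ell 0 1 with ho
  have ho0 : 0 < 1 + o.at 0 := by have := hφ.order_pos; simpa [ho] using this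
  set T : Set Expo := {ell 0 1} + (compCone φ J : Set Expo) with hT
  set P : Set Expo := shear (-(1 + o.at 0)⁻¹ • o) '' T with hPdef
  have hinv : ∀ γ, leadExpo φ (shear (-(1 + o.at 0)⁻¹ • o) γ) = γ := shear_shear_inv ho0.ne'
  have hPT : ∀ β ∈ P, leadExpo φ β ∈ T := by
    rintro _ ⟨γ, hγ, rfl⟩
    rwa [hinv]
  have hTP : ∀ γ ∈ T, γ ∈ leadExpo φ '' P := fun γ hγ => ⟨_, ⟨γ, hγ, rfl⟩, hinv γ⟩
  have hPtame : Tame J P := by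
    refine Tame.image_shear ((Tame.singleton (ell_mem_depth (Nat.zero_le _) _)).add
      hφ.tame_compCone) (Submodule.smul_mem _ _ hφ.order_sub_mem) ?_
    have : 1 + (-(1 + o.at 0)⁻¹ • o).at 0 = (1 + o.at 0)⁻¹ := by
      rw [at_smul]; field_simp; ring
    rw [this]
    positivity
  have hker : ∀ β ∈ P, compKernel φ J β = monoComp φ β := fun β hβ =>
    IsPosInf.compKernel_of_mem (hPtame.subset_depth hβ)
  obtain ⟨h, hhP, hh⟩ := exists_kernelMap_eq (hφ.isKernel J) hPtame.isPWO
    (hφ.strictMono_leadExpo.strictMonoOn P) (b := X)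
    (fun β hβ => by
      rw [hker β hβ, hφ.coeff_monoComp_of_le le_rfl, coeff_single_same]
      exact (hφ.leadingCoeff_monoComp β).ne')
    (fun β hβ γ hγ => by
      rw [hker β hβ] at hγ
      rw [← hφ.order_monoComp]
      exact order_le_of_coeff_ne_zero hγ)
    (fun β hβ γ hγ => by
      obtain ⟨_, rfl, s, hs, rfl⟩ := hφ.support_compKernel_subset J β hγ
      obtain ⟨x, hx, s', hs', hxs⟩ := hPT β hβ
      refine hTP _ ⟨x, hx, s' + s, add_mem hs' hs, ?_⟩
      simp only at hxs ⊢
      rw [← add_assoc, hxs])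
    (fun γ hγ => hTP γ ⟨ell 0 1, rfl, 0, zero_mem _, by
      simp only [add_zero]; exact (eq_of_mem_support_single hγ).symm⟩)
  have hmem : h ∈ LInf J := LInf.of_subset hPtame hhP
  have hcomp : hφ.comp J h = X := hh
  have h0 : h ≠ 0 := by
    rintro rfl
    rw [hφ.comp_zero] at hcomp
    exact single_ne_zero one_ne_zero hcomp.symm
  obtain ⟨hord, hlc⟩ := hφ.order_comp hmem h0
  rw [hcomp, X_eq_single, order_single one_ne_zero] at hord
  rw [hcomp, X_eq_single, leadingCoeff_of_single] at hlc
  -- Admissibility of `h` is read off by comparing the leading term of `h ∘ φ` with that of `x`.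
  refine ⟨h, ⟨⟨?_, ?_⟩, hmem, hφ.pos, fun i hi => ?_⟩, hcomp⟩
  · by_contra! hle
    have := mul_nonpos_of_nonpos_of_nonneg hle (hφ.leadingCoeff_monoComp h.order).le
    linarith
  · have h1 : h.order.at 0 * φ.order.at 0 = 1 := by
      rw [← IsPosInf.leadExpo_at_zero, ← hord, at_ell_self]
    by_contra! hle
    have := mul_nonpos_of_nonpos_of_nonneg hle hφ.order_pos.le
    linarith
  · have h1 : (leadExpo φ h.order).at i = 0 := by
      rw [← hord, at_ell, if_neg (by have := hφ.pos; omega)]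
    rw [leadExpo, shear_at, at_sub, hφ.order_at i hi, at_ell,
      if_neg (by have := hφ.pos; omega)] at h1
    simpa using h1

/-- With `h ∘ φ = x` and `k ∘ h = x`, associativity gives `φ = (k ∘ h) ∘ φ = k ∘ (h ∘ φ) = k`, so
`φ` is also a left inverse of `h`. -/
lemma exists_inverse : ∃ h, ∃ hh : Admissible J h, hφ.comp J h = X ∧ hh.comp J φ = X := by
  obtain ⟨h, hh, hφh⟩ := hφ.exists_left_inverse
  obtain ⟨k, hk, hhk⟩ := hh.exists_left_inverse
  have hpos : IsPosInf (hφ.comp J h) := hφh ▸ isPosInf_X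
  have h1 := hφ.comp_comp hh hk.mem hpos
  have h2 : hpos.comp J k = k := by
    have : ∀ {ω : Series} (hω : IsPosInf ω), ω = X → hω.comp J k = k := by
      rintro _ hω rfl
      exact comp_X_right (support_subset_depth hk.mem)
    exact this hpos hφh
  rw [hhk, hφ.comp_X, h2] at h1
  exact ⟨h, hh, hφh, h1 ▸ hhk⟩

end Admissible

lemma LFrak.exists_common {F G : Series} (hF : F ∈ LFrak) (hG : G ∈ LFrak) :
    ∃ J, F ∈ LInf J ∧ G ∈ LInf J := by
  obtain ⟨i, hi⟩ := hF
  obtain ⟨j, hj⟩ := hG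
  exact ⟨max i j, LInf.mono (le_max_left i j) hi, LInf.mono (le_max_right i j) hj⟩

lemma IsComp.left_injective {φ χ h h' : Series} (hh : h ∈ LFrak) (hh' : h' ∈ LFrak)
    (hc : IsComp h φ χ) (hc' : IsComp h' φ χ) : h = h' := by
  obtain ⟨J, h1, h2⟩ := LFrak.exists_common hh hh'
  have hsub := LInf.sub_mem h1 h2
  have := (hc.sub hc').eq_comp hc.isPosInf (support_subset_depth hsub)
  rw [sub_self] at this
  by_contra hne
  exact hc.isPosInf.comp_ne_zero hsub (sub_ne_zero.2 hne) this.symm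

lemma Admissible.existsUnique_formalInverse {J : ℕ} {φ : Series} (hφ : Admissible J φ) :
    ∃! h, IsFormalInverse φ h := by
  obtain ⟨h, hh, h1, h2⟩ := hφ.exists_inverse
  have hc1 : IsComp φ h X := h2 ▸ hh.isComp_comp (support_subset_depth hφ.mem)
  have hc2 : IsComp h φ X := h1 ▸ hφ.isComp_comp (support_subset_depth hh.mem)
  exact ⟨h, ⟨⟨J, hh.mem⟩, hc1, hc2⟩, fun k hk => IsComp.left_injective hk.1 ⟨J, hh.mem⟩ hk.2.2 hc2⟩

/-! ### Leading terms -/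

/-- `F` is the sum of `c` times the monomial with exponent `t` and of smaller monomials. -/
def LeadsWith (t : Expo) (c : ℝ) (F : Series) : Prop :=
  ∀ γ ≤ t, F.coeff γ = (single t c : Series).coeff γ

namespace LeadsWith

variable {t : Expo} {c d : ℝ} {F G : Series}

lemma coeff_self (h : LeadsWith t c F) : F.coeff t = c := by
  rw [h t le_rfl, coeff_single_same]

lemma le_of_mem (h : LeadsWith t c F) {γ : Expo} (hγ : γ ∈ F.support) : t ≤ γ := by
  by_contra! hlt
  refine hγ ?_
  rw [h γ hlt.le, coeff_single_of_ne hlt.ne]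

lemma zero_of_lt (h : ∀ γ ∈ F.support, t < γ) : LeadsWith t 0 F := fun γ hγ => by
  rw [map_zero, coeff_zero]
  by_contra hne
  exact absurd (h γ hne) (not_lt.2 hγ)

lemma add (hF : LeadsWith t c F) (hG : LeadsWith t d G) : LeadsWith t (c + d) (F + G) :=
  fun γ hγ => by rw [coeff_add, hF γ hγ, hG γ hγ, single_add, coeff_add]

lemma neg (hF : LeadsWith t c F) : LeadsWith t (-c) (-F) :=
  fun γ hγ => by rw [coeff_neg, hF γ hγ, single_neg, coeff_neg]

lemma single_mul (s : Expo) (a : ℝ) (hF : LeadsWith t c F) :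
    LeadsWith (s + t) (a * c) (single s a * F) := fun γ hγ => by
  rw [coeff_single_mul, hF _ (sub_le_iff_le_add'.2 hγ), ← single_mul_single, coeff_single_mul]

lemma C_mul (a : ℝ) (hF : LeadsWith t c F) : LeadsWith t (a * c) (C a * F) := by
  simpa [C_apply] using hF.single_mul 0 a

lemma of_lt {s : Expo} (hF : LeadsWith t c F) (h : s < t) : LeadsWith s 0 F :=
  zero_of_lt fun _ hγ => h.trans_le (hF.le_of_mem hγ)

lemma mul (ht : 0 < t) (hF : LeadsWith t c F) (hG : LeadsWith t d G) : LeadsWith t 0 (F * G) := by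
  refine zero_of_lt fun γ hγ => ?_
  obtain ⟨a, ha, b, hb, rfl⟩ := support_mul_subset hγ
  exact lt_add_of_le_of_pos (hF.le_of_mem ha) (ht.trans_le (hG.le_of_mem hb))

lemma heval (ht : 0 < t) (hF : LeadsWith t c F) (p : PowerSeries ℝ) :
    LeadsWith t (p.coeff 1 * c) (PowerSeries.heval F p - C (p.coeff 0)) := by
  have hpos : 0 < F.orderTop := by
    have : IsPrincipal (1 + F) := isPrincipal_iff.2 fun γ hγ => by
      rw [add_sub_cancel_left] at hγ
      exact ht.trans_le (hF.le_of_mem hγ)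
    simpa [IsPrincipal] using this
  rw [heval_eq_add F hpos, add_assoc, add_sub_cancel_left]
  nth_rw 1 [← add_zero (p.coeff 1 * c)]
  refine (hF.C_mul _).add (zero_of_lt fun γ hγ => ?_)
  obtain ⟨_, hmul, b, hb, rfl⟩ := support_mul_subset hγ
  obtain ⟨a, ha, a', ha', rfl⟩ := support_mul_subset hmul
  have h1 := hF.le_of_mem ha
  have h2 := ht.trans_le (hF.le_of_mem ha')
  have h3 : 0 ≤ b := nonneg_of_mem_closure
    (fun γ hγ => (ht.trans_le (hF.le_of_mem hγ)).le) (support_heval_subset _ _ hb)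
  exact lt_add_of_lt_of_nonneg (lt_add_of_le_of_pos h1 h2) h3

lemma isPrincipal {U : Series} (ht : 0 < t) (hU : LeadsWith t c (U - 1)) : IsPrincipal U :=
  isPrincipal_iff.2 fun _ hγ => ht.trans_le (hU.le_of_mem hγ)

lemma upow {U : Series} (ht : 0 < t) (hU : LeadsWith t c (U - 1)) (b : ℝ) :
    LeadsWith t (b * c) (upow U b - 1) := by
  have := hU.heval ht (PowerSeries.binomialSeries ℝ b)
  rwa [PowerSeries.binomialSeries_coeff, PowerSeries.binomialSeries_coeff, Ring.choose_one_right,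
    Ring.choose_zero_right, one_smul, smul_eq_mul, mul_one, C_one] at this

lemma ulog {U : Series} (ht : 0 < t) (hU : LeadsWith t c (U - 1)) : LeadsWith t c (ulog U) := by
  have := hU.heval ht (PowerSeries.log ℝ)
  rwa [PowerSeries.coeff_one_log, one_mul, PowerSeries.coeff_log, if_pos rfl, C_zero,
    sub_zero] at this

lemma prod (ht : 0 < t) {ι : Type*} {s : Finset ι} {U : ι → Series} {c : ι → ℝ}
    (h : ∀ i ∈ s, LeadsWith t (c i) (U i - 1)) :
    LeadsWith t (∑ i ∈ s, c i) (∏ i ∈ s, U i - 1) := by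
  classical
  induction s using Finset.induction_on with
  | empty => exact fun γ _ => by simp
  | insert i s hi ih =>
    rw [Finset.forall_mem_insert] at h
    rw [Finset.prod_insert hi, Finset.sum_insert hi]
    -- In `U V - 1 = (U - 1) + (V - 1) + (U - 1) (V - 1)` the last product only has exponents beyond
    -- `t`, because `t > 0`.
    have h1 := (h.1.add (ih h.2)).add (h.1.mul ht (ih h.2))
    rw [add_zero] at h1
    convert h1 using 1
    ring

end LeadsWith

/-! ### Parabolic series -/

/-- The exponent of `ℓ₁ * ⋯ * ℓ_k`. -/
def ellProd (k : ℕ) : Expo := ∑ i ∈ Finset.range k, ell (i + 1) 1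

lemma ellProd_succ (k : ℕ) : ellProd (k + 1) = ellProd k + ell (k + 1) 1 :=
  Finset.sum_range_succ _ _

lemma ellProd_at (k j : ℕ) : (ellProd k).at j = if 1 ≤ j ∧ j ≤ k then 1 else 0 := by
  induction k with
  | zero => rw [if_neg (by omega)]; rfl
  | succ k ih =>
    rw [ellProd_succ, at_add, ih, at_ell]
    split_ifs <;> first | omega | simp

lemma ellProd_mem_depth {J k : ℕ} (h : k ≤ J) : ellProd k ∈ depth J := fun i hi => by
  rw [ellProd_at, if_neg (by omega)]

lemma ellProd_strictMono : StrictMono ellProd :=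
  strictMono_nat_of_lt_succ fun k => by
    rw [ellProd_succ]
    exact lt_add_of_pos_right _ (ell_pos _ one_pos)

/-- The first index with a nonzero exponent. -/
def firstIdx (β : Expo) : ℕ := sInf {k | β.at k ≠ 0}

lemma at_firstIdx_ne_zero {β : Expo} (h : β ≠ 0) : β.at (firstIdx β) ≠ 0 := by
  obtain ⟨k, hk, -⟩ := exists_at_ne_zero h
  exact Nat.sInf_mem (s := {k | β.at k ≠ 0}) ⟨k, hk⟩

lemma at_eq_zero_of_lt_firstIdx {β : Expo} {i : ℕ} (h : i < firstIdx β) : β.at i = 0 := by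
  by_contra hne
  exact Nat.notMem_of_lt_sInf h hne

lemma firstIdx_eq {β : Expo} {k : ℕ} (hk : β.at k ≠ 0) (h : ∀ i < k, β.at i = 0) :
    firstIdx β = k := by
  have hle : firstIdx β ≤ k := Nat.sInf_le hk
  refine le_antisymm hle ?_
  by_contra! hlt
  exact at_firstIdx_ne_zero (fun h0 => hk (by rw [h0]; rfl)) (h _ hlt)

/-- The exponent of `x * m'`, up to a translation of the leading exponent of `m ∘ f - m`. -/
def shiftExpo (t : Expo) (β : Expo) : Expo := β + (t + ellProd (firstIdx β))

/-- With equal first indices both exponents are translated alike. Otherwise the first place `m`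
where `β` and `γ` differ is at most both first indices, and the two added vectors agree up to and
including `m`, so the comparison is unchanged. -/
lemma shiftExpo_strictMonoOn (t : Expo) : StrictMonoOn (shiftExpo t) {β | β ≠ 0} := by
  intro β hβ γ hγ hlt
  rcases eq_or_ne (firstIdx β) (firstIdx γ) with heq | hne
  · rw [shiftExpo, shiftExpo, heq]
    exact add_lt_add_left hlt _
  · obtain ⟨m, hm, hmlt⟩ := lt_iff.1 hlt
    have hmβ : m ≤ firstIdx β ∧ m ≤ firstIdx γ := by
      rcases lt_or_gt_of_ne hne with h | h
      · have : m ≤ firstIdx β := by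
          by_contra! hc
          exact at_firstIdx_ne_zero hβ ((hm _ hc).trans (at_eq_zero_of_lt_firstIdx h))
        omega
      · have : m ≤ firstIdx γ := by
          by_contra! hc
          exact at_firstIdx_ne_zero hγ ((hm _ hc).symm.trans (at_eq_zero_of_lt_firstIdx h))
        omega
    have he : ∀ j ≤ m, (ellProd (firstIdx β)).at j = (ellProd (firstIdx γ)).at j := by
      intro j hj
      rw [ellProd_at, ellProd_at]
      congr 1
      simp only [eq_iff_iff]
      omega
    refine lt_of_at_lt (k := m) (fun i hi => ?_) ?_
    · simp only [shiftExpo, at_add, hm i hi, he i hi.le]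
    · simp only [shiftExpo, at_add, he m le_rfl]
      linarith

/-- A series `x - c * x * m_t + ⋯` with `m_t` infinitesimal and `c ≠ 0`, in `x` and `ℓ`. -/
structure Parabolic (f : Series) (t : Expo) (κ : ℝ) : Prop where
  mem : f ∈ LInf 1
  order_eq : f.order = ell 0 1
  leadingCoeff_eq : f.leadingCoeff = 1
  pos : 0 < t
  ne_zero : κ ≠ 0
  leadsWith : LeadsWith t κ (unitPart f - 1)

namespace Parabolic

variable {f : Series} {t : Expo} {κ : ℝ} (hf : Parabolic f t κ)
include hf

lemma isPosInf : IsPosInf f :=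
  ⟨by rw [hf.leadingCoeff_eq]; exact one_pos, by rw [hf.order_eq]; simp⟩

lemma admissible {J : ℕ} (hJ : 1 ≤ J) : Admissible J f :=
  ⟨hf.isPosInf, LInf.mono hJ hf.mem, hJ, fun i hi => by
    rw [hf.order_eq, at_ell, if_neg (by omega)]⟩

lemma add_ellProd_pos (k : ℕ) : 0 < t + ellProd k := by
  have : ellProd 0 ≤ ellProd k := ellProd_strictMono.monotone (Nat.zero_le k)
  exact add_pos_of_pos_of_nonneg hf.pos this

/-- This is the first-order Taylor term: `x ℓ_i' = ℓ_i * (ℓ₁ ⋯ ℓ_i)`. Inductively, `-log` of `ℓ_i (1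
+ ε)` is `ℓ_{i+1}⁻¹ (1 - ℓ_{i+1} log (1 + ε))`, and inverting it multiplies the relative correction
by `ℓ_{i+1}` without changing `κ`. -/
lemma ellComp_eq (i : ℕ) : ellComp f i = single (ell i 1) 1 * unitPart (ellComp f i) ∧
    LeadsWith (t + ellProd i) κ (unitPart (ellComp f i) - 1) := by
  induction i with
  | zero =>
    refine ⟨?_, ?_⟩
    · have := single_mul_unitPart (leadingCoeff_ne_zero.1 hf.isPosInf.1.ne')
      rw [hf.order_eq, hf.leadingCoeff_eq] at this
      exact this.symm
    · have := hf.leadsWith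
      rwa [← add_zero t] at this
  | succ i ih =>
    obtain ⟨h1, h2⟩ := ih
    have hpos := hf.add_ellProd_pos i
    have hlog : -log (ellComp f i) = single (ell (i + 1) (-1)) 1 *
        (1 - single (ell (i + 1) 1) 1 * ulog (unitPart (ellComp f i))) := by
      conv_lhs => rw [h1, log_single_mul one_ne_zero (h2.isPrincipal hpos), Real.log_one, map_zero,
        zero_add, logMono_ell, ellPow, single_neg]
      rw [mul_sub, mul_one, ← mul_assoc, single_mul_single, ← ell_add, mul_one, neg_add_cancel,
        show ell (i + 1) 0 = 0 from Finsupp.single_zero _, single_zero_one, one_mul]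
      ring
    set V := 1 - single (ell (i + 1) 1) 1 * ulog (unitPart (ellComp f i)) with hV
    have hVlead : LeadsWith (t + ellProd (i + 1)) (-κ) (V - 1) := by
      have := ((h2.ulog hpos).single_mul (ell (i + 1) 1) 1).neg
      rw [one_mul] at this
      rw [hV, ellProd_succ, ← add_assoc, add_comm (t + ellProd i)]
      convert this using 1
      ring
    have hVpos := hf.add_ellProd_pos (i + 1)
    have hVp := hVlead.isPrincipal hVpos
    have hinv : ellComp f (i + 1) = single (ell (i + 1) 1) 1 * upow V (-1) := by
      rw [show ellComp f (i + 1) = (-log (ellComp f i))⁻¹ from rfl,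
        ← rpow_neg_one (hf.isPosInf.leadingCoeff_neg_log_ellComp i), hlog,
        rpow_single_mul one_ne_zero hVp, smul_ell, Real.one_rpow, neg_mul_neg, one_mul]
    have hunit : unitPart (ellComp f (i + 1)) = upow V (-1) := by
      rw [hinv, unitPart_single_mul one_ne_zero (hVp.upow _)]
    rw [hunit]
    refine ⟨hinv, ?_⟩
    have := hVlead.upow hVpos (-1)
    rwa [neg_mul_neg, one_mul] at this

lemma isPrincipal_unitPart_ellComp (i : ℕ) : IsPrincipal (unitPart (ellComp f i)) :=
  (hf.ellComp_eq i).2.isPrincipal (hf.add_ellProd_pos i)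

lemma leadExpo_eq (β : Expo) : leadExpo f β = β := by
  rw [leadExpo, hf.order_eq, sub_self, shear_apply, smul_zero, add_zero]

lemma monoComp_eq (β : Expo) : monoComp f β = single β 1 * monoUnit f β := by
  have h1 : (monoComp f β).leadingCoeff = 1 := by
    rw [monoComp, Finsupp.prod, leadingCoeff_prod]
    refine Finset.prod_eq_one fun i _ => ?_
    rw [(hf.ellComp_eq i).1, rpow_single_mul one_ne_zero (hf.isPrincipal_unitPart_ellComp i),
      leadingCoeff_single_mul ((hf.isPrincipal_unitPart_ellComp i).upow _), Real.one_rpow]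
  have := hf.isPosInf.monoComp_eq β
  rwa [h1, hf.leadExpo_eq] at this

/-- The relative correction of `ℓ_i ∘ f` has exponent `t + ellProd i`, which increases with `i`. So
the first factor present in the monomial alone determines the leading correction. -/
lemma leadsWith_monoUnit {β : Expo} (hβ : β ≠ 0) :
    LeadsWith (t + ellProd (firstIdx β)) (β.at (firstIdx β) * κ) (monoUnit f β - 1) := by
  classical
  set k := firstIdx β with hk
  have hpos := hf.add_ellProd_pos k
  have h : ∀ i ∈ (ofLex β).support, LeadsWith (t + ellProd k)
      (if i = k then β.at k * κ else 0) (upow (unitPart (ellComp f i)) (ofLex β i) - 1) := by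
    intro i hi
    have hl := (hf.ellComp_eq i).2.upow (hf.add_ellProd_pos i) (ofLex β i)
    split_ifs with hik
    · subst hik; exact hl
    · refine hl.of_lt (add_lt_add_right (ellProd_strictMono ?_) t)
      refine lt_of_le_of_ne ?_ (Ne.symm hik)
      by_contra! hlt
      exact (Finsupp.mem_support_iff.1 hi) (at_eq_zero_of_lt_firstIdx hlt)
  have := LeadsWith.prod hpos h
  rwa [Finset.sum_ite_eq', if_pos (Finsupp.mem_support_iff.2 (at_firstIdx_ne_zero hβ))] at this

lemma leadsWith_monoComp_sub {β : Expo} (hβ : β ≠ 0) :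
    LeadsWith (shiftExpo t β) (β.at (firstIdx β) * κ) (monoComp f β - single β 1) := by
  have := (hf.leadsWith_monoUnit hβ).single_mul β 1
  rw [one_mul, mul_sub, mul_one, ← hf.monoComp_eq] at this
  exact this

/-- The kernel of `ψ ↦ ψ ∘ f - ψ`. -/
def _root_.Transseries.diffKernel (f : Series) (J : ℕ) (β : Expo) : Series :=
  compKernel f J β - compKernel X J β

omit hf in
lemma diffKernel_of_mem {J : ℕ} {β : Expo} (h : β ∈ depth J) :
    diffKernel f J β = monoComp f β - single β 1 := by
  rw [diffKernel, IsPosInf.compKernel_of_mem h, IsPosInf.compKernel_of_mem h, monoComp_X]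

lemma isKernel_diffKernel (J : ℕ) : IsKernel (diffKernel f J) := by
  intro A hA
  obtain ⟨h1, h2⟩ := hf.isPosInf.isKernel J A hA
  obtain ⟨h3, h4⟩ := isPosInf_X.isKernel J A hA
  refine ⟨(h1.union h3).mono (Set.iUnion₂_subset fun β hβ => ?_), fun γ => ?_⟩
  · refine (support_sub_subset _ _).trans (Set.union_subset_union ?_ ?_)
    · exact Set.subset_biUnion_of_mem (u := fun β => (compKernel f J β).support) hβ
    · exact Set.subset_biUnion_of_mem (u := fun β => (compKernel X J β).support) hβ
  · refine ((h2 γ).union (h4 γ)).subset ?_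
    rintro β ⟨hβ, hne⟩
    rcases support_sub_subset _ _ hne with h | h
    · exact Or.inl ⟨hβ, h⟩
    · exact Or.inr ⟨hβ, h⟩

lemma kernelMap_diffKernel {J : ℕ} {ψ : Series} (hψ : ψ.support ⊆ depth J) :
    kernelMap (hf.isKernel_diffKernel J) ψ = hf.isPosInf.comp J ψ - ψ := by
  have h : kernelMap (hf.isKernel_diffKernel J) ψ =
      hf.isPosInf.comp J ψ - isPosInf_X.comp J ψ := by
    rw [IsPosInf.comp, IsPosInf.comp, kernelMap, kernelMap, kernelMap, ← SummableFamily.hsum_sub]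
    congr 1
    ext1 β
    rw [SummableFamily.sub_apply, kernelFamily_apply, kernelFamily_apply, kernelFamily_apply,
      diffKernel, smul_sub]
  rw [h, comp_X_right hψ]

/-! ### Fatou coordinates -/

/-- After removing the constant term, a leading exponent `β ≠ 0` would produce a nonzero coefficient
of `ψ ∘ f - ψ` at `shiftExpo t β`, where no later monomial can cancel it. -/
lemma eq_C_of_comp_eq_self {J : ℕ} {ψ : Series} (hψ : ψ ∈ LInf J)
    (h : hf.isPosInf.comp J ψ = ψ) : ψ = C (ψ.coeff 0) := by
  by_contra hne
  set Δ := ψ - C (ψ.coeff 0) with hΔ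
  have hΔ0 : Δ ≠ 0 := sub_ne_zero.2 hne
  have hΔJ : Δ.support ⊆ depth J := support_subset_depth (LInf.sub_mem hψ (LInf.C_mem _))
  have hzero : kernelMap (hf.isKernel_diffKernel J) Δ = 0 := by
    rw [hf.kernelMap_diffKernel hΔJ, hΔ, IsPosInf.comp_sub, IsPosInf.comp_C, h, sub_self]
  have hcoeff0 : Δ.coeff 0 = 0 := by
    rw [hΔ, coeff_sub, C_apply, coeff_single_same, sub_self]
  have hsupp : ∀ β ∈ Δ.support, β ≠ 0 := by
    rintro _ hβ rfl
    exact hβ hcoeff0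
  have hord : Δ.order ∈ Δ.support := by rwa [mem_support, Ne, coeff_order_eq_zero]
  have hord0 := hsupp _ hord
  have hlead : ∀ β ∈ Δ.support,
      LeadsWith (shiftExpo t β) (β.at (firstIdx β) * κ) (diffKernel f J β) := fun β hβ => by
    rw [diffKernel_of_mem (hΔJ hβ)]
    exact hf.leadsWith_monoComp_sub (hsupp β hβ)
  have hκ : Δ.order.at (firstIdx Δ.order) * κ ≠ 0 :=
    mul_ne_zero (at_firstIdx_ne_zero hord0) hf.ne_zero
  have hc := coeff_kernelMap (hf.isKernel_diffKernel J) (isPWO_support Δ)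
    (shiftExpo t Δ.order) subset_rfl
  rw [hzero, coeff_zero, Finset.sum_eq_single_of_mem Δ.order] at hc
  · rw [(hlead _ hord).coeff_self] at hc
    exact mul_ne_zero hord hκ hc.symm
  · rw [Set.Finite.mem_toFinset]
    exact ⟨hord, by rw [(hlead _ hord).coeff_self]; exact hκ⟩
  · intro β hβ hβne
    obtain ⟨hβs, hne'⟩ := (Set.Finite.mem_toFinset _).1 hβ
    have hlt : Δ.order < β :=
      lt_of_le_of_ne (order_le_of_coeff_ne_zero hβs) (Ne.symm hβne)
    exact absurd ((hlead β hβs).le_of_mem hne')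
      (not_le.2 (shiftExpo_strictMonoOn t hord0 (hsupp β hβs) hlt))

/-! ### Solving the Fatou equation in depth 2 -/

lemma t_mem_depth : t ∈ depth 1 := by
  have h : t ∈ (unitPart f - 1).support := by
    rw [mem_support, hf.leadsWith.coeff_self]
    exact hf.ne_zero
  exact support_subset_depth (LInf.sub_mem (LInf.unitPart_mem hf.mem) LInf.one_mem) h

/-- Every leading exponent in `x` and `ℓ` is attained, if the monomial `ℓ₂⁻¹` is added. -/
lemma exists_shiftExpo_eq {γ : Expo} (hγ : γ ∈ depth 1) :
    ∃ β, (β ∈ depth 1 ∧ β ≠ 0 ∨ β = ell 2 (-1)) ∧ shiftExpo t β = γ ∧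
      ∃ k ≤ 2, β = γ + -(t + ellProd k) := by
  have ht := hf.t_mem_depth
  have key : ∀ β k, firstIdx β = k → k ≤ 2 → (β ∈ depth 1 ∧ β ≠ 0 ∨ β = ell 2 (-1)) →
      β = γ + -(t + ellProd k) → ∃ β, (β ∈ depth 1 ∧ β ≠ 0 ∨ β = ell 2 (-1)) ∧
      shiftExpo t β = γ ∧ ∃ k ≤ 2, β = γ + -(t + ellProd k) := by
    intro β k hk hk2 hβ h
    refine ⟨β, hβ, ?_, k, hk2, h⟩
    rw [shiftExpo, hk, h, neg_add_cancel_right]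
  have hmem : ∀ k ≤ 1, γ + -(t + ellProd k) ∈ depth 1 := fun k hk =>
    add_mem hγ (neg_mem (add_mem ht (ellProd_mem_depth hk)))
  have hne : ∀ {β : Expo} {k : ℕ}, β.at k ≠ 0 → β ≠ 0 := by
    rintro _ k h rfl
    exact h rfl
  have hat : ∀ k i, (γ + -(t + ellProd k)).at i =
      γ.at i - t.at i - if 1 ≤ i ∧ i ≤ k then 1 else 0 := by
    intro k i
    rw [at_add, at_neg, at_add, ellProd_at]; ring
  -- The candidate `γ - t - ellProd k` is a preimage only if its first index is `k`. This fails for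
  -- `k = 0` when `γ.at 0 = t.at 0`, and for `k = 1` when also `γ.at 1 = t.at 1 + 1`. What remains
  -- is `γ = t + ell 1 1`, which is hit by `ℓ₂⁻¹`.
  by_cases h0 : γ.at 0 = t.at 0
  · by_cases h1 : γ.at 1 - t.at 1 = 1
    · refine key (ell 2 (-1)) 2 (firstIdx_eq (by simp) fun i hi => ?_) le_rfl (Or.inr rfl) ?_
      · rw [at_ell, if_neg hi.ne']
      · ext i
        rw [hat, at_ell]
        rcases i with _ | _ | _ | i
        · simp [h0]
        · simp [h1]
        · simp [hγ 2 (by omega), ht 2 (by omega)]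
        · simp [hγ (i + 3) (by omega), ht (i + 3) (by omega)]
    · have hk : (γ + -(t + ellProd 1)).at 1 ≠ 0 := by
        rw [hat]; simpa [sub_eq_zero] using h1
      refine key _ 1 (firstIdx_eq hk fun i hi => ?_) (by omega) (Or.inl ⟨hmem 1 le_rfl, hne hk⟩) rfl
      obtain rfl : i = 0 := by omega
      rw [hat]; simp [h0]
  · have hk : (γ + -(t + ellProd 0)).at 0 ≠ 0 := by
      rw [hat]; simpa [sub_eq_zero] using h0
    exact key _ 0 (firstIdx_eq hk fun i hi => absurd hi (Nat.not_lt_zero i)) (by omega)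
      (Or.inl ⟨hmem 0 (by omega), hne hk⟩) rfl

omit hf in
lemma support_unitPart_ellComp_subset {i : ℕ} (hi : i ≤ 1) :
    cone (unitPart (ellComp f i)) ⊆ compCone f 1 :=
  AddSubmonoid.closure_mono
    (Set.subset_biUnion_of_mem (u := fun i => (unitPart (ellComp f i) - 1).support) hi)

/-- As `ℓ₂⁻¹ = -log ℓ₁`, the leading logarithm cancels in the difference and no `ℓ₂` is left. Thus
the extra unknown `ℓ₂⁻¹` creates no right-hand sides outside `x` and `ℓ₁`. -/
lemma monoComp_ell_two_sub : monoComp f (ell 2 (-1)) - single (ell 2 (-1)) 1 =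
    -ulog (unitPart (ellComp f 1)) := by
  obtain ⟨h1, h2⟩ := hf.ellComp_eq 1
  have hp := hf.isPrincipal_unitPart_ellComp 1
  rw [hf.isPosInf.monoComp_ell, hf.isPosInf.neg_log_ellComp]
  conv_lhs => rw [h1, log_single_mul one_ne_zero hp, Real.log_one, map_zero,
    zero_add, logMono_ell, ellPow, single_neg]
  norm_num

/-- The supports of the differences `m ∘ f - m` for the monomials `m` in `x` and `ℓ` and for
`m = ℓ₂⁻¹`. -/
lemma support_monoComp_sub_subset {β : Expo} (hβ : β ∈ depth 1 ∧ β ≠ 0 ∨ β = ell 2 (-1)) :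
    ∃ δ ∈ ({0, ell 2 1} : Set Expo), β + δ ∈ depth 1 ∧
      (monoComp f β - single β 1).support ⊆ {β + δ} + (compCone f 1 : Set Expo) := by
  rcases hβ with ⟨hβ, -⟩ | rfl
  · refine ⟨0, by simp, by rwa [add_zero], ?_⟩
    rw [add_zero]
    refine (support_sub_subset _ _).trans (Set.union_subset ?_ ?_)
    · have := hf.isPosInf.support_monoComp_subset hβ
      rwa [hf.leadExpo_eq] at this
    · refine support_single_subset.trans (Set.singleton_subset_iff.2 ?_)
      exact ⟨β, rfl, 0, zero_mem _, add_zero _⟩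
  · have h0 : ell 2 (-1) + ell 2 1 = 0 := by
      rw [← ell_add, neg_add_cancel]; exact Finsupp.single_zero _
    refine ⟨ell 2 1, by simp, by rw [h0]; exact zero_mem _, ?_⟩
    rw [h0, hf.monoComp_ell_two_sub, support_neg]
    intro γ hγ
    exact ⟨0, rfl, γ, support_unitPart_ellComp_subset le_rfl (support_ulog_subset _ hγ),
      zero_add _⟩

/-- The unknown exponents `Q` are the nonzero ones in `x, ℓ₁` together with that of `ℓ₂⁻¹`: their
images under `shiftExpo t` cover everything that their differences can produce. It remains to find a
tame part of `Q` that is closed under the recursion. -/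
lemma exists_fatou : ∃ Ψ ∈ LInf 2, hf.isPosInf.comp 2 Ψ - Ψ = 1 ∧
    ∀ γ ∈ Ψ.support, -t.at 0 ≤ γ.at 0 := by
  set Q : Set Expo := {β | β ∈ depth 1 ∧ β ≠ 0 ∨ β = ell 2 (-1)} with hQ
  -- The right-hand side `1` has exponent `0`, so the recursion starts at its preimage `β₀`.
  obtain ⟨β₀, hβ₀Q, hβ₀, k₀, -, hβ₀'⟩ := hf.exists_shiftExpo_eq (γ := 0) (zero_mem _)
  set E : Set Expo := ⋃ k ∈ Set.Iic 2, {-(t + ellProd k)} with hE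
  -- These are the possible increments from an unknown `β` to the unknown `β'` whose leading
  -- exponent occurs in the difference of `β`: one element of the cone, the shift `ell 2 1` if `β`
  -- belongs to `ℓ₂⁻¹`, and the correction `-(t + ellProd k)`. Keeping only the nonnegative ones
  -- makes `Tame.closure` applicable.
  set S : Set Expo := {δ | 0 ≤ δ ∧ δ ∈ ((compCone f 1 : Set Expo) + {0, ell 2 1}) + E} with hS
  have ht2 : t ∈ depth 2 := fun i hi => hf.t_mem_depth i (by omega)
  have hQ2 : Q ⊆ depth 2 := by
    rintro β (⟨hβ, -⟩ | rfl)
    · exact fun i hi => hβ i (by omega)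
    · exact ell_mem_depth le_rfl _
  have hQ0 : Q ⊆ {β | β ≠ 0} := by
    rintro β (⟨-, hβ⟩ | rfl)
    · exact hβ
    · intro h
      have := congrArg (fun γ : Expo => γ.at 2) h
      simp at this
  have hStame : Tame 2 S := by
    refine Tame.mono (Tame.add (Tame.add ?_ ?_) ?_) (fun δ hδ => hδ.2)
    · exact ((hf.admissible le_rfl).tame_compCone).mono_depth (by omega)
    · exact (Tame.singleton (zero_mem _)).union (Tame.singleton (ell_mem_depth le_rfl _))
    · exact Tame.biUnion (Set.finite_Iic 2) fun k hk =>
        Tame.singleton (neg_mem (add_mem ht2 (ellProd_mem_depth hk)))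
  set P : Set Expo := {β | β ∈ Q ∧ β ∈ {β₀} + (AddSubmonoid.closure S : Set Expo)} with hP
  have hPtame : Tame 2 P :=
    ((Tame.singleton (hQ2 hβ₀Q)).add (hStame.closure fun δ hδ => hδ.1)).mono fun β hβ => hβ.2
  have hτ := (shiftExpo_strictMonoOn t).mono hQ0
  have hK : ∀ β ∈ Q, diffKernel f 2 β = monoComp f β - single β 1 := fun β hβ =>
    diffKernel_of_mem (hQ2 hβ)
  have hlead : ∀ β ∈ Q, LeadsWith (shiftExpo t β) (β.at (firstIdx β) * κ) (diffKernel f 2 β) :=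
    fun β hβ => by
      rw [hK β hβ]
      exact hf.leadsWith_monoComp_sub (hQ0 hβ)
  obtain ⟨Ψ, hΨP, hΨ⟩ := exists_kernelMap_eq (hf.isKernel_diffKernel 2) hPtame.isPWO
    (hτ.mono fun β hβ => hβ.1) (b := 1)
    (fun β hβ => by
      rw [(hlead β hβ.1).coeff_self]
      exact mul_ne_zero (at_firstIdx_ne_zero (hQ0 hβ.1)) hf.ne_zero)
    (fun β hβ γ hγ => (hlead β hβ.1).le_of_mem hγ)
    (fun β hβ γ hγ => by
      have hle := (hlead β hβ.1).le_of_mem hγ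
      obtain ⟨δ, hδ, hβδ, hsub⟩ := hf.support_monoComp_sub_subset hβ.1
      rw [hK β hβ.1] at hγ
      obtain ⟨_, rfl, s, hs, rfl⟩ := hsub hγ
      have hsdepth : s ∈ depth 1 := (hf.admissible le_rfl).tame_compCone.subset_depth hs
      obtain ⟨β', hβ'Q, hβ', k, hk, hβ'k⟩ := hf.exists_shiftExpo_eq (add_mem hβδ hsdepth)
      simp only at hle ⊢
      refine ⟨β', ⟨hβ'Q, ?_⟩, hβ'⟩
      -- The increment is nonnegative because `shiftExpo t` is strictly increasing and every
      -- exponent in the difference of `β` is at least `shiftExpo t β`.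
      have hge : β ≤ β' := by
        by_contra! hlt
        have := hτ hβ'Q hβ.1 hlt
        rw [hβ'] at this
        exact absurd hle (not_le.2 this)
      have hdiff : β' - β ∈ S := by
        refine ⟨sub_nonneg.2 hge, s + δ, ⟨s, hs, δ, hδ, rfl⟩, -(t + ellProd k),
          Set.mem_iUnion₂.2 ⟨k, hk, rfl⟩, ?_⟩
        simp only
        rw [hβ'k]
        abel
      obtain ⟨b, hb, c, hc, hcβ⟩ := hβ.2
      rw [Set.mem_singleton_iff.1 hb] at hcβ
      refine ⟨β₀, rfl, c + (β' - β), add_mem hc (AddSubmonoid.subset_closure hdiff), ?_⟩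
      simp only at hcβ ⊢
      rw [← add_assoc, hcβ, add_sub_cancel])
    (fun γ hγ => by
      rw [support_one] at hγ
      obtain rfl : γ = 0 := hγ
      exact ⟨β₀, ⟨hβ₀Q, β₀, rfl, 0, zero_mem _, add_zero _⟩, hβ₀⟩)
  have hΨ2 : Ψ ∈ LInf 2 := LInf.of_subset hPtame hΨP
  refine ⟨Ψ, hΨ2, ?_, fun γ hγ => ?_⟩
  · rw [← hf.kernelMap_diffKernel (support_subset_depth hΨ2), hΨ]
  · obtain ⟨b, hb, c, hc, rfl⟩ := (hΨP hγ).2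
    have h1 : (0 : ℝ) ≤ c.at 0 := at_zero_le (nonneg_of_mem_closure (fun δ hδ => hδ.1) hc)
    have h2 : β₀.at 0 = -t.at 0 := by
      rw [hβ₀', zero_add, at_neg, at_add, ellProd_at, if_neg (by omega), add_zero]
    simp only [at_add, Set.mem_singleton_iff.1 hb, h2]
    linarith

end Parabolic

/-! ### Formal inverse, Fatou coordinate and length -/

lemma leadsWith_order {F : Series} : LeadsWith F.order F.leadingCoeff F := fun γ hγ => by
  rcases hγ.eq_or_lt with rfl | hlt
  · rw [coeff_single_same, leadingCoeff_eq]
  · rw [coeff_single_of_ne hlt.ne, coeff_eq_zero_of_lt_order hlt]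

/-- Since `f / x - 1 = -g / x` with `g = x - f`, the data `t` and `κ` come from the leading term of
`g`; `t > 0` because the leading terms of `x` and `f` cancel in `g`. -/
lemma IsParabolic.parabolic {f : Series} (hpar : IsParabolic f) (hf : f ∈ LInf 1)
    (hg : X - f ≠ 0) :
    Parabolic f ((X - f).order - ell 0 1) (-(X - f).leadingCoeff) := by
  obtain ⟨hord, hlc⟩ := hpar
  refine ⟨hf, hord, hlc, ?_, neg_ne_zero.2 (leadingCoeff_ne_zero.2 hg), ?_⟩
  · rw [sub_pos]
    by_contra! hle
    refine hg (coeff_order_eq_zero.1 ?_)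
    rcases hle.eq_or_lt with heq | hlt
    · have : f.coeff (ell 0 1) = 1 := by rw [← hord, ← leadingCoeff_eq, hlc]
      rw [heq, coeff_sub, X_eq_single, coeff_single_same, this, sub_self]
    · generalize (X - f).order = o at hlt
      rw [coeff_sub, X_eq_single, coeff_single_of_ne hlt.ne, coeff_eq_zero_of_lt_order (hord ▸ hlt), sub_self]
  · have h : unitPart f - 1 = -(single (-ell 0 1) 1 * (X - f)) := by
      rw [unitPart, hord, hlc, inv_one, mul_sub, X_eq_single, single_mul_single, neg_add_cancel,
        one_mul, single_zero_one]
      ring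
    rw [h]
    have := ((leadsWith_order (F := X - f)).single_mul (-ell 0 1) 1).neg
    rwa [one_mul, neg_add_eq_sub] at this

/-- The leading monomial of `x - f` may contain a power of `ℓ₁`, whose logarithm involves `ℓ₂`;
hence the level 2, although `x - f` itself has depth 1. -/
lemma admissible_id_sub {f : Series} (hf : f ∈ L 1) (hattr : 0 < (X - f).leadingCoeff) :
    Admissible 2 (X - f) := by
  have hmem : X - f ∈ LInf 1 := LInf.sub_mem (X_mem 1) hf.1
  refine ⟨⟨hattr, ?_⟩, LInf.mono one_le_two hmem, one_le_two, fun i hi =>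
    LInf.order_mem hmem i (by omega)⟩
  have h0 : (X - f).order ∈ (X - f).support := by
    rw [mem_support, Ne, coeff_order_eq_zero]
    exact leadingCoeff_ne_zero.1 hattr.ne'
  rcases support_sub_subset _ _ h0 with h | h
  · rw [eq_of_mem_support_single h]; simp
  · exact hf.2 _ h

lemma smul_X_eq (c : ℝ) : c • X = single (ell 0 1) c := by
  rw [X_eq_single, ← C_mul_eq_smul, C_apply, single_mul_single, zero_add, mul_one]

lemma admissible_smul_X {J : ℕ} (hJ : 1 ≤ J) {c : ℝ} (hc : 0 < c) : Admissible J (c • X) := by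
  have hord : (c • X).order = ell 0 1 := by rw [smul_X_eq, order_single hc.ne']
  refine ⟨⟨?_, ?_⟩, LInf.smul_mem _ (X_mem J), hJ, fun i hi => ?_⟩
  · rwa [smul_X_eq, leadingCoeff_of_single]
  · rw [hord]; simp
  · rw [hord, at_ell, if_neg (by omega)]

lemma IsFormalFatou.sub_eq_C {f t κ Ψ Ψ'} (hf : Parabolic f t κ) (h : IsFormalFatou f Ψ)
    (h' : IsFormalFatou f Ψ') : ∃ c : ℝ, Ψ - Ψ' = C c := by
  obtain ⟨hΨ, χ, hχ, h1⟩ := h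
  obtain ⟨hΨ', χ', hχ', h1'⟩ := h'
  obtain ⟨J, hJ, hJ'⟩ := LFrak.exists_common hΨ hΨ'
  have hmem := LInf.sub_mem hJ hJ'
  have hcomp := (hχ.sub hχ').eq_comp hf.isPosInf (support_subset_depth hmem)
  refine ⟨_, hf.eq_C_of_comp_eq_self hmem ?_⟩
  rw [← hcomp]
  linear_combination h1 - h1'

/-- The inverse is unique, so the only freedom is the constant `c` in `Ψ`. It is unchanged by
composition and contributes `2 c ε`. -/
lemma IsFormalLength.sub_eq_smul {f t κ A A'} (hf : Parabolic f t κ)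
    (h : IsFormalLength f A) (h' : IsFormalLength f A') : ∃ K : ℝ, A - A' = K • X := by
  obtain ⟨k, Ψ, k₂, Φ, hk, hΨ, hk₂, hΦ, rfl⟩ := h
  obtain ⟨k', Ψ', k₂', Φ', hk', hΨ', hk₂', hΦ', rfl⟩ := h'
  obtain rfl : k = k' := IsComp.left_injective hk.1 hk'.1 hk.2.2 hk'.2.2
  obtain rfl : k₂ = k₂' := hk₂.unique hk₂'
  obtain ⟨c, hc⟩ := hΨ.sub_eq_C hf hΨ'
  have hΦc : Φ - Φ' = C c := (hc ▸ hΦ.sub hΦ').unique (isComp_C hΦ.isPosInf c)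
  refine ⟨2 * c, ?_⟩
  rw [add_sub_add_left_eq_sub, ← mul_sub, hΦc, ← C_mul_eq_smul, ← C_mul_eq_smul, map_mul]
  ring

/-- There is a formal length in `L₂`. -/
lemma exists_formalLength {f : Series} (hf : f ∈ L 1) (hpar : IsParabolic f)
    (hattr : 0 < (X - f).leadingCoeff) : ∃ A ∈ L 2, IsFormalLength f A := by
  have hg := admissible_id_sub hf hattr
  have hp := hpar.parabolic hf.1 (leadingCoeff_ne_zero.1 hattr.ne')
  obtain ⟨h, hh, hgh, hhg⟩ := hg.exists_inverse
  obtain ⟨Ψ, hΨ, hΨ1, hΨ0⟩ := hp.exists_fatou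
  have h2X : Admissible 2 ((2 : ℝ) • X) := admissible_smul_X one_le_two two_pos
  have hlead : ∀ β, leadExpo ((2 : ℝ) • X) β = β := fun β => by
    rw [leadExpo, smul_X_eq, order_single two_ne_zero, sub_self, shear_apply, smul_zero, add_zero]
  have hord : (h2X.comp 2 h).order = h.order := by
    rw [(h2X.order_comp hh.mem (leadingCoeff_ne_zero.1 hh.leadingCoeff_pos.ne')).1, hlead]
  have hh₂ : Admissible 2 (h2X.comp 2 h) := ⟨h2X.comp_comp_isPosInf hh.mem hh.toIsPosInf,
    h2X.comp_mem hh.mem, one_le_two, fun i hi => by rw [hord]; exact hh.order_at i hi⟩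
  -- The leading powers of `x` in mutually inverse series have reciprocal exponents.
  have hα : h.order.at 0 * (X - f).order.at 0 = 1 := by
    have := (hg.order_comp hh.mem (leadingCoeff_ne_zero.1 hh.leadingCoeff_pos.ne')).1
    rw [hgh, X_eq_single, order_single one_ne_zero] at this
    rw [← IsPosInf.leadExpo_at_zero, X_eq_single, ← this, at_ell_self]
  have hpos := hh.order_pos
  have hc1 := hh.isComp_comp (support_subset_depth hg.mem)
  have hc2 := hg.isComp_comp (support_subset_depth hh.mem)
  rw [hhg] at hc1
  rw [hgh] at hc2
  refine ⟨h2X.comp 2 h + ((2 : ℝ) • X) * hh₂.comp 2 Ψ, ⟨LInf.add_mem hh₂.mem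
    (LInf.mul_mem h2X.mem (hh₂.comp_mem hΨ)), fun γ hγ => ?_⟩, h, Ψ, _, _,
    ⟨⟨2, hh.mem⟩, hc1, hc2⟩,
    ⟨⟨2, hΨ⟩, _, hp.isPosInf.isComp_comp (support_subset_depth hΨ), hΨ1⟩,
    h2X.isComp_comp (support_subset_depth hh.mem),
    hh₂.isComp_comp (support_subset_depth hΨ), rfl⟩
  rcases support_add_subset _ _ hγ with hγ | hγ
  · have := at_zero_le (order_le_of_coeff_ne_zero hγ)
    rw [hord] at this
    linarith
  -- With `α = (X - f).order.at 0`, so that `t.at 0 = α - 1`, the exponents of `x` in `Ψ` are at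
  -- least `1 - α`; composing multiplies this bound by `1 / α`, and the factor `2ε` adds `1`, giving
  -- at least `1 / α`.
  · obtain ⟨a, ha, _, hb, rfl⟩ := support_mul_subset hγ
    obtain ⟨_, ⟨β, hβ, rfl⟩, s, hs, rfl⟩ := hh₂.support_comp_subset _ hb
    rw [smul_X_eq] at ha
    have h1 := hΨ0 β hβ
    have h2 : (0 : ℝ) ≤ s.at 0 := at_zero_le (hh₂.nonneg_of_mem_compCone hs)
    simp only [at_add, eq_of_mem_support_single ha, at_ell_self, IsPosInf.leadExpo_at_zero, hord,
      at_sub] at h1 ⊢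
    nlinarith [mul_le_mul_of_nonneg_right h1 hpos.le]

end

end Transseries

/-! ### Theorem A -/

theorem theoremA (f : Transseries.Series) (hf : f ∈ Transseries.LHat)
    (hpar : Transseries.IsParabolic f)
    (hattr : 0 < (Transseries.X - f).leadingCoeff) :
    (∃! h, Transseries.IsFormalInverse (Transseries.X - f) h) ∧
    (∃ Ψ, Transseries.IsFormalFatou f Ψ) ∧
    (∀ Ψ₁ Ψ₂, Transseries.IsFormalFatou f Ψ₁ → Transseries.IsFormalFatou f Ψ₂ →
      ∃ c : ℝ, Ψ₁ - Ψ₂ = HahnSeries.C c) ∧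
    (∃ A, Transseries.IsFormalLength f A) ∧
    (∀ A, Transseries.IsFormalLength f A → A ∈ Transseries.L 2) ∧
    (∀ A₁ A₂, Transseries.IsFormalLength f A₁ → Transseries.IsFormalLength f A₂ →
      ∃ K : ℝ, A₁ - A₂ = K • Transseries.X) := by
  have hp := hpar.parabolic hf.1.1 (HahnSeries.leadingCoeff_ne_zero.1 hattr.ne')
  obtain ⟨A, hA, hlen⟩ := Transseries.exists_formalLength hf.1 hpar hattr
  have hlen' := hlen
  obtain ⟨_, Ψ, _, _, _, hΨ, _⟩ := hlen'
  refine ⟨(Transseries.admissible_id_sub hf.1 hattr).existsUnique_formalInverse, ⟨Ψ, hΨ⟩,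
    fun _ _ h₁ h₂ => h₁.sub_eq_C hp h₂, ⟨A, hlen⟩, fun B hB => ?_,
    fun _ _ h₁ h₂ => h₁.sub_eq_smul hp h₂⟩
  -- An arbitrary length differs from the constructed one by a multiple of `X`, which lies in `L 2`
  -- as well.
  obtain ⟨K, hK⟩ := hB.sub_eq_smul hp hlen
  rw [sub_eq_iff_eq_add.1 hK]
  refine ⟨Transseries.LInf.add_mem (Transseries.LInf.smul_mem K (Transseries.X_mem 2)) hA.1,
    fun γ hγ => ?_⟩
  rcases HahnSeries.support_add_subset _ _ hγ with h | h
  · rw [Transseries.smul_X_eq] at h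
    rw [HahnSeries.eq_of_mem_support_single h, Transseries.Expo.at_ell_self]
    exact one_pos
  · exact hA.2 γ h
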